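/- Let $\lambda\in\mathbb{R}$. There exist $A_0=A_0(\lambda)$ and $n_0=n_0(\lambda)$ such that the following holds for all integers $n\ge n_0$ and $3\le d\le n-1$ with $nd$ even, and for every real $A\ge A_0$. The number $p=\frac{1+\lambda n^{-1/3}}{d-1}$ lies in $[0,1]$. Let $G_{n,d}$ be chosen uniformly at random among all simple $d$-regular graphs on $n$ labelled vertices, let $G_{n,d,p}$ be the random graph obtained from $G_{n,d}$ by retaining each edge independently with probability $p$, and let $L_1(G_{n,d,p})$ be the number of vertices in a largest connected component of $G_{n,d,p}$. Then $$ \mathbb{P}\left[L_1(G_{n,d,p})\notin [A^{-1}n^{2/3},\,A n^{2/3}]\right]\le 20A^{-1/2}. $$ -/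

import Mathlib

open MeasureTheory ProbabilityTheory

/-- The set of all simple `d`-regular graphs on the labelled vertex set `Fin n`. -/
def regularGraphs (n d : ℕ) : Set (SimpleGraph (Fin n)) :=
  {G | ∀ v, (G.neighborSet v).ncard = d}

/-- Bond percolation on a graph `G`: the law of the random spanning subgraph of `G` that retains
each edge of `G` independently with probability `p`. -/
noncomputable def percolation {V : Type*} (G : SimpleGraph V) (p : unitInterval) :
    Measure (SimpleGraph V) :=
  (setBernoulli G.edgeSet p).map SimpleGraph.fromEdgeSet

/-- The law of the percolated random regular graph: choose a `d`-regular graph on `Fin n` uniformly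
at random, then retain each of its edges independently with probability `p`. -/
noncomputable def percolatedRegularGraph (n d : ℕ) (p : unitInterval) :
    Measure (SimpleGraph (Fin n)) :=
  (uniformOn (regularGraphs n d)).bind fun G => percolation G p

/-- The order (number of vertices) of a largest connected component of a finite graph. -/
noncomputable def largestComponentOrder {V : Type*} [Finite V] (H : SimpleGraph V) : ℕ :=
  ⨆ C : H.ConnectedComponent, C.supp.ncard

/-- On finitely many vertices single graphs are measurable, so all sets of graphs are. -/
instance measurableSingletonClass_simpleGraph {V : Type*} [Finite V] :
    MeasurableSingletonClass (SimpleGraph V) where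
  measurableSet_singleton G := by
    have h : SimpleGraph.edgeSet ⁻¹' {G.edgeSet} = {G} := by ext; simp
    exact h ▸ SimpleGraph.measurableEmbedding_edgeSet.measurable (measurableSet_singleton _)

/-- As soon as there is a `d`-regular graph on `n` vertices, the law of the percolated random
regular graph is a probability measure. -/
theorem isProbabilityMeasure_percolatedRegularGraph {n d : ℕ} (p : unitInterval)
    (h : (regularGraphs n d).Nonempty) : IsProbabilityMeasure (percolatedRegularGraph n d p) := by
  have := isProbabilityMeasure_uniformOn (Set.toFinite (regularGraphs n d)) h
  refine isProbabilityMeasure_bind (measurable_of_finite _).aemeasurable (.of_forall fun G => ?_)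
  exact Measure.isProbabilityMeasure_map SimpleGraph.measurable_fromEdgeSet.aemeasurable

/-! Write N = n^(1/3) and ε = λ/N, so that p(d-1) = 1 + ε. Clusters are revealed vertex by vertex: X
is the set of explored vertices and U the set of active ones. Exposing the edges at v ∈ U moves v
into X and its retained neighbours into U (`percExp_expose`, `card_clus_sup_starGraph`).

Upper tail. This works on every fixed d-regular graph. The exploration is dominated by a branching
process with binomial (d-1, p) offspring, so a y with 1 - y ≤ s(1-py)^(d-1) forces E s^|C(v)| ≥ 1 -
2y (`one_sub_le_percExp`). By `NearCritical.subsolution`, s = 1 - 1/N² and some y of order 1/N are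
admissible. Summing 1 - s^|C(v)| over v and applying Markov's inequality shows that a cluster of
size A N² has probability O(1/A) (`percExp_exists_large_le`).

Lower tail. Here the graph must be random. Only the neighbourhoods of explored vertices are
revealed; given these, switching bounds the probability that two other vertices are adjacent by
16d/n (`card_adj_le`). Hence few edges lead back to U or to vertices that already have neighbours in
X (`sum_overlap_le`). Weight an active vertex by its number of unexposed edges divided by d-1. The
total weight Y is then almost a martingale, and one step has variance of the order of the weight of
the explored vertex (`stepMean_ge`, `stepVar_ge`). Therefore 4H² - Y² decreases on average and Y
climbs to a level H within O(H²) steps, restarting from a new vertex whenever U is exhausted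
(`sum_percExp_all_clus_lt_le`). From level H on, the squared shortfall below H grows by at most 145
per step on average, so U survives k further steps except with probability 145k/H²
(`sum_percExp_clus_lt_le`). With r = A^(1/10), H = N/r², k ≈ N²/r^10 and a climbing time of about
r²N²/10^5, both errors are O(r^-6), which is below r^-5 = A^(-1/2). -/

/-! ### Finite expectations over Bernoulli subsets -/

section BernoulliSubsets

open Finset

/-- The expectation of `Φ S`, where `S` is the random subset of `E` that contains each element
independently with probability `p`. -/
noncomputable def bexp {α : Type*} (p : ℝ) (E : Finset α) (Φ : Finset α → ℝ) : ℝ :=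
  ∑ S ∈ E.powerset, p ^ #S * (1 - p) ^ (#E - #S) * Φ S

variable {α β : Type*} {p : ℝ} {E F : Finset α}

theorem bexp_empty (Φ : Finset α → ℝ) : bexp p ∅ Φ = Φ ∅ := by
  simp [bexp]

theorem bexp_insert [DecidableEq α] {a : α} (ha : a ∉ E) (Φ : Finset α → ℝ) :
    bexp p (insert a E) Φ =
      (1 - p) * bexp p E Φ + p * bexp p E (fun S => Φ (insert a S)) := by
  unfold bexp
  rw [Finset.sum_powerset_insert ha, Finset.mul_sum, Finset.mul_sum]
  congr 1
  · refine Finset.sum_congr rfl fun S hS => ?_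
    rw [Finset.card_insert_of_notMem ha,
      Nat.succ_sub (Finset.card_le_card (Finset.mem_powerset.1 hS)), pow_succ]
    ring
  · refine Finset.sum_congr rfl fun S hS => ?_
    have haS : a ∉ S := fun h => ha (Finset.mem_powerset.1 hS h)
    rw [Finset.card_insert_of_notMem haS, Finset.card_insert_of_notMem ha, Nat.add_sub_add_right]
    ring

theorem bexp_congr {Φ Ψ : Finset α → ℝ} (h : ∀ S ⊆ E, Φ S = Ψ S) : bexp p E Φ = bexp p E Ψ :=
  Finset.sum_congr rfl fun S hS => by rw [h S (Finset.mem_powerset.1 hS)]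

theorem bexp_mono (h0 : 0 ≤ p) (h1 : p ≤ 1) {Φ Ψ : Finset α → ℝ} (h : ∀ S ⊆ E, Φ S ≤ Ψ S) :
    bexp p E Φ ≤ bexp p E Ψ :=
  Finset.sum_le_sum fun S hS => mul_le_mul_of_nonneg_left (h S (Finset.mem_powerset.1 hS))
    (mul_nonneg (pow_nonneg h0 _) (pow_nonneg (by linarith) _))

theorem bexp_add (Φ Ψ : Finset α → ℝ) :
    bexp p E (fun S => Φ S + Ψ S) = bexp p E Φ + bexp p E Ψ := by
  simp [bexp, mul_add, Finset.sum_add_distrib]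

theorem bexp_const_mul (c : ℝ) (Φ : Finset α → ℝ) :
    bexp p E (fun S => c * Φ S) = c * bexp p E Φ := by
  simp only [bexp, Finset.mul_sum]
  exact Finset.sum_congr rfl fun S _ => by ring

theorem bexp_sum {ι : Type*} (I : Finset ι) (Φ : ι → Finset α → ℝ) :
    bexp p E (fun S => ∑ i ∈ I, Φ i S) = ∑ i ∈ I, bexp p E (Φ i) := by
  simp only [bexp, Finset.mul_sum]
  exact Finset.sum_comm

theorem bexp_pow_card (c : ℝ) : bexp p E (fun S => c ^ #S) = (1 - p + p * c) ^ #E := by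
  unfold bexp
  rw [add_comm, ← Finset.sum_pow_mul_eq_add_pow]
  refine Finset.sum_congr rfl fun S hS => ?_
  rw [mul_pow]
  ring

theorem bexp_const (c : ℝ) : bexp p E (fun _ => c) = c := by
  have h := bexp_pow_card (p := p) (E := E) 1
  simp only [one_pow] at h
  have h2 := bexp_const_mul (p := p) (E := E) c (fun _ => 1)
  rw [h] at h2
  simpa using h2

theorem bexp_union [DecidableEq α] (h : Disjoint E F) (Φ : Finset α → ℝ) :
    bexp p (E ∪ F) Φ = bexp p E (fun S => bexp p F (fun T => Φ (S ∪ T))) := by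
  induction E using Finset.induction_on generalizing Φ with
  | empty => simp [bexp_empty]
  | insert a E ha ih =>
    rw [Finset.disjoint_insert_left] at h
    rw [Finset.insert_union, bexp_insert (by simp [ha, h.1]), bexp_insert ha, ih h.2, ih h.2]
    simp only [Finset.insert_union]

theorem bexp_image [DecidableEq α] {f : β → α} (hf : Function.Injective f) (E : Finset β) (Φ : Finset α → ℝ) :
    bexp p (E.image f) Φ = bexp p E (fun S => Φ (S.image f)) := by
  classical
  induction E using Finset.induction_on generalizing Φ with
  | empty => simp [bexp_empty]
  | insert a E ha ih =>
    rw [Finset.image_insert, bexp_insert (by simpa [hf.eq_iff] using ha), bexp_insert ha, ih, ih]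
    simp only [Finset.image_insert]

theorem bexp_add_sum (c : ℝ) (x : α → ℝ) :
    bexp p E (fun S => c + ∑ u ∈ S, x u) = c + p * ∑ u ∈ E, x u := by
  classical
  induction E using Finset.induction_on generalizing c with
  | empty => simp [bexp_empty]
  | insert a E ha ih =>
    have h : bexp p E (fun S => c + ∑ u ∈ insert a S, x u) =
        bexp p E (fun S => (c + x a) + ∑ u ∈ S, x u) := by
      refine bexp_congr fun S hS => ?_
      rw [Finset.sum_insert (fun h => ha (hS h))]
      ring
    rw [bexp_insert ha, h, ih, ih, Finset.sum_insert ha]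
    ring

/-- Squared mean plus variance of a sum of independent terms. The offset `c` absorbs the
contribution of an inserted element in the induction. -/
theorem bexp_add_sum_sq (c : ℝ) (x : α → ℝ) :
    bexp p E (fun S => (c + ∑ u ∈ S, x u) ^ 2) =
      (c + p * ∑ u ∈ E, x u) ^ 2 + p * (1 - p) * ∑ u ∈ E, x u ^ 2 := by
  classical
  induction E using Finset.induction_on generalizing c with
  | empty => simp [bexp_empty]
  | insert a E ha ih =>
    have h : bexp p E (fun S => (c + ∑ u ∈ insert a S, x u) ^ 2) =
        bexp p E (fun S => ((c + x a) + ∑ u ∈ S, x u) ^ 2) := by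
      refine bexp_congr fun S hS => ?_
      rw [Finset.sum_insert (fun h => ha (hS h))]
      ring
    rw [bexp_insert ha, h, ih, ih, Finset.sum_insert ha, Finset.sum_insert ha]
    ring

theorem nat_cube_le_two_pow (r : ℕ) : r ^ 3 ≤ 7 * 2 ^ r := by
  induction r with
  | zero => norm_num
  | succ r ih =>
    rcases Nat.lt_or_ge r 4 with h | h
    · interval_cases r <;> norm_num
    · have : (r + 1) ^ 3 ≤ 2 * r ^ 3 := by
        obtain ⟨s, rfl⟩ := Nat.exists_eq_add_of_le h
        ring_nf
        nlinarith [sq_nonneg s, Nat.zero_le (s ^ 3)]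
      calc (r + 1) ^ 3 ≤ 2 * r ^ 3 := this
        _ ≤ 2 * (7 * 2 ^ r) := by omega
        _ = 7 * 2 ^ (r + 1) := by ring

/-- Cubes are dominated by `7 * 2 ^ r`, and the generating function at 2 is at most exp 2 ≤ 9,
whence 63 = 7 · 9. The third moment controls both the squared increments and the overshoot of a
level. -/
theorem bexp_card_cube_le (h0 : 0 ≤ p) (h1 : p ≤ 1) (hE : p * #E ≤ 2) :
    bexp p E (fun S => (#S : ℝ) ^ 3) ≤ 63 := by
  have h2 : bexp p E (fun S => (#S : ℝ) ^ 3) ≤ bexp p E (fun S => 7 * 2 ^ #S) :=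
    bexp_mono h0 h1 fun S _ => by exact_mod_cast nat_cube_le_two_pow #S
  rw [bexp_const_mul, bexp_pow_card] at h2
  have h3 : (1 - p + p * 2) ^ #E ≤ Real.exp 2 := by
    calc (1 - p + p * 2) ^ #E ≤ (Real.exp p) ^ #E := by
          refine pow_le_pow_left₀ (by linarith) ?_ _
          linarith [Real.add_one_le_exp p]
      _ = Real.exp (#E * p) := by rw [← Real.exp_nat_mul]
      _ ≤ Real.exp 2 := Real.exp_le_exp.2 (by linarith)
  have h4 : Real.exp 2 ≤ 9 := by
    have : Real.exp 2 = Real.exp 1 ^ 2 := by rw [← Real.exp_nat_mul]; norm_num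
    rw [this]
    nlinarith [Real.exp_one_lt_d9, Real.exp_pos 1]
  linarith

end BernoulliSubsets

/-! ### Clusters and their exploration -/

section Exploration

open scoped Classical
open Finset

variable {V : Type*}

/-- The star with centre `v` and set of leaves `R`. -/
def starGraph (v : V) (R : Finset V) : SimpleGraph V :=
  SimpleGraph.fromEdgeSet ↑(R.image fun u => s(v, u))

theorem starGraph_adj {v : V} {R : Finset V} {a b : V} :
    (starGraph v R).Adj a b ↔ a ≠ b ∧ (a = v ∧ b ∈ R ∨ b = v ∧ a ∈ R) := by
  simp only [starGraph, SimpleGraph.fromEdgeSet_adj, Finset.coe_image, Set.mem_image,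
    Finset.mem_coe, Sym2.eq_iff]
  grind

variable [Fintype V]

/-- The neighbourhood of `v` in `G`, as a finset. -/
noncomputable def nb (G : SimpleGraph V) (v : V) : Finset V := univ.filter (G.Adj v)

@[simp] theorem mem_nb {G : SimpleGraph V} {v w : V} : w ∈ nb G v ↔ G.Adj v w := by simp [nb]

/-- The vertices of `H` that are reachable from the set `U`. -/
noncomputable def clus (H : SimpleGraph V) (U : Finset V) : Finset V :=
  univ.filter fun w => ∃ u ∈ U, H.Reachable u w

@[simp] theorem mem_clus {H : SimpleGraph V} {U : Finset V} {w : V} :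
    w ∈ clus H U ↔ ∃ u ∈ U, H.Reachable u w := by simp [clus]

theorem subset_clus (H : SimpleGraph V) (U : Finset V) : U ⊆ clus H U :=
  fun u hu => mem_clus.2 ⟨u, hu, .refl u⟩

theorem clus_mono {H H' : SimpleGraph V} {U U' : Finset V} (hH : H ≤ H') (hU : U ⊆ U') :
    clus H U ⊆ clus H' U' := by
  intro w hw
  obtain ⟨u, hu, h⟩ := mem_clus.1 hw
  exact mem_clus.2 ⟨u, hU hu, h.mono hH⟩

/-- Exploring a vertex `v` of the active set `U`: afterwards the neighbours of `v` are active. -/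
theorem clus_sup_starGraph {H : SimpleGraph V} {v : V} {U R : Finset V} (hv : v ∈ U) (hR : v ∉ R)
    (hH : ∀ y, ¬ H.Adj v y) :
    clus (H ⊔ starGraph v R) U = insert v (clus H (U.erase v ∪ R)) := by
  apply Finset.Subset.antisymm
  · intro w hw
    obtain ⟨u, hu, ⟨q⟩⟩ := mem_clus.1 hw
    have hu' : u ∈ insert v (clus H (U.erase v ∪ R)) := by
      by_cases huv : u = v
      · simp [huv]
      · exact Finset.mem_insert_of_mem (subset_clus _ _ (by simp [huv, hu]))
    clear hw hu
    induction q with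
    | nil => exact hu'
    | @cons a b c hab _ ih =>
      apply ih
      rcases hab with hab | hab
      · have hav : a ≠ v := by rintro rfl; exact hH _ hab
        obtain ⟨x, hx, hxa⟩ := mem_clus.1 ((Finset.mem_insert.1 hu').resolve_left hav)
        exact Finset.mem_insert_of_mem (mem_clus.2 ⟨x, hx, hxa.trans hab.reachable⟩)
      · rcases (starGraph_adj.1 hab).2 with ⟨-, hb⟩ | ⟨hb, -⟩
        · exact Finset.mem_insert_of_mem (subset_clus _ _ (by simp [hb]))
        · simp [hb]
  · intro w hw
    rcases Finset.mem_insert.1 hw with rfl | hw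
    · exact subset_clus _ _ hv
    · obtain ⟨x, hx, hxw⟩ := mem_clus.1 hw
      have hxw' : (H ⊔ starGraph v R).Reachable x w := hxw.mono le_sup_left
      rcases Finset.mem_union.1 hx with hx | hx
      · exact mem_clus.2 ⟨x, Finset.mem_of_mem_erase hx, hxw'⟩
      · refine mem_clus.2 ⟨v, hv, SimpleGraph.Reachable.trans (SimpleGraph.Adj.reachable ?_) hxw'⟩
        refine Or.inr (starGraph_adj.2 ⟨?_, Or.inl ⟨rfl, hx⟩⟩)
        rintro rfl
        exact hR hx

theorem notMem_clus_of_isolated {H : SimpleGraph V} {v : V} {U : Finset V} (hv : v ∉ U)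
    (hH : ∀ y, ¬ H.Adj v y) : v ∉ clus H U := by
  intro h
  obtain ⟨u, hu, huv⟩ := mem_clus.1 h
  obtain ⟨q⟩ := huv.symm
  cases q with
  | nil => exact hv hu
  | cons h _ => exact hH _ h

/-- Once its star is removed, v is isolated, so it is not counted again: each exploration step
accounts for exactly one vertex of the cluster. -/
theorem card_clus_sup_starGraph {H : SimpleGraph V} {v : V} {U R : Finset V} (hv : v ∈ U)
    (hR : v ∉ R) (hH : ∀ y, ¬ H.Adj v y) :
    #(clus (H ⊔ starGraph v R) U) = #(clus H (U.erase v ∪ R)) + 1 := by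
  rw [clus_sup_starGraph hv hR hH, Finset.card_insert_of_notMem]
  exact notMem_clus_of_isolated (by simp [hR]) hH

theorem clus_empty (H : SimpleGraph V) : clus H ∅ = ∅ := by ext; simp

/-- The edges of `G` that avoid the vertex set `X`. -/
noncomputable def edgesOff (G : SimpleGraph V) (X : Finset V) : Finset (Sym2 V) :=
  univ.filter fun e => e ∈ G.edgeSet ∧ ∀ x ∈ X, x ∉ e

/-- The expectation of `Φ H`, where `H` is the percolation of the subgraph of `G` formed by the
edges that avoid `X`. -/
noncomputable def percExp (p : ℝ) (G : SimpleGraph V) (X : Finset V) (Φ : SimpleGraph V → ℝ) : ℝ :=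
  bexp p (edgesOff G X) fun S => Φ (SimpleGraph.fromEdgeSet ↑S)

variable {p : ℝ} {G : SimpleGraph V} {X : Finset V}

theorem percExp_mono (h0 : 0 ≤ p) (h1 : p ≤ 1) {Φ Ψ : SimpleGraph V → ℝ}
    (h : ∀ H : SimpleGraph V, (∀ x ∈ X, ∀ y, ¬ H.Adj x y) → Φ H ≤ Ψ H) :
    percExp p G X Φ ≤ percExp p G X Ψ := by
  refine bexp_mono h0 h1 fun S hS => h _ fun x hx y hxy => ?_
  have := hS (by simpa using (SimpleGraph.fromEdgeSet_adj _).1 hxy |>.1)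
  simp only [edgesOff, Finset.mem_filter] at this
  exact this.2.2 x hx (by simp)

theorem percExp_const (c : ℝ) : percExp p G X (fun _ => c) = c := bexp_const c

theorem percExp_const_mul (c : ℝ) (Φ : SimpleGraph V → ℝ) :
    percExp p G X (fun H => c * Φ H) = c * percExp p G X Φ := bexp_const_mul _ _

/-- Expose the edges at `v` first. -/
theorem percExp_expose {v : V} (hv : v ∉ X) (Φ : SimpleGraph V → ℝ) :
    percExp p G X Φ = bexp p (nb G v \ X) fun R =>
      percExp p G (insert v X) fun H => Φ (H ⊔ starGraph v R) := by
  have hinj : Function.Injective fun u : V => s(v, u) := fun a b h => by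
    rcases Sym2.eq_iff.1 h with ⟨-, h⟩ | ⟨h, h'⟩
    · exact h
    · exact h'.trans h
  have hE : edgesOff G X = (nb G v \ X).image (fun u => s(v, u)) ∪ edgesOff G (insert v X) := by
    ext e
    induction e with
    | _ a b =>
      simp only [edgesOff, Finset.mem_filter, Finset.mem_univ, true_and, SimpleGraph.mem_edgeSet,
        Sym2.mem_iff, Finset.mem_union, Finset.mem_image, Finset.mem_sdiff, mem_nb,
        Finset.mem_insert, Sym2.eq_iff]
      constructor
      · rintro ⟨hab, h⟩
        by_cases h1 : a = v
        · subst h1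
          exact Or.inl ⟨b, ⟨hab, fun hb => h b hb (by simp)⟩, by simp⟩
        by_cases h2 : b = v
        · subst h2
          exact Or.inl ⟨a, ⟨hab.symm, fun hb => h a hb (by simp)⟩, by simp⟩
        · refine Or.inr ⟨hab, ?_⟩
          rintro x (rfl | hx)
          · rintro (h' | h') <;> simp_all
          · exact h x hx
      · rintro (⟨u, ⟨hu, huX⟩, ⟨rfl, rfl⟩ | ⟨rfl, rfl⟩⟩ | ⟨hab, h⟩)
        · refine ⟨hu, ?_⟩
          rintro x hx (rfl | rfl) <;> contradiction
        · refine ⟨hu.symm, ?_⟩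
          rintro x hx (rfl | rfl) <;> contradiction
        · exact ⟨hab, fun x hx => h x (Or.inr hx)⟩
  have hdisj : Disjoint ((nb G v \ X).image (fun u => s(v, u))) (edgesOff G (insert v X)) := by
    rw [Finset.disjoint_left]
    intro e he he'
    obtain ⟨u, -, rfl⟩ := Finset.mem_image.1 he
    exact (Finset.mem_filter.1 he').2.2 v (by simp) (by simp)
  rw [percExp, hE, bexp_union hdisj, bexp_image hinj]
  refine bexp_congr fun R _ => ?_
  rw [percExp]
  refine bexp_congr fun S _ => ?_
  rw [starGraph, ← SimpleGraph.fromEdgeSet_union, Finset.coe_union, Set.union_comm]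

end Exploration

/-! ### Switchings in regular graphs and adjacency probabilities -/

section Switching

open scoped Classical
open Finset

variable {V : Type*} {G : SimpleGraph V} {v w x y : V}

/-- Replace the edges `vw` and `xy` by `vx` and `wy`. -/
def switchEdges (G : SimpleGraph V) (v w x y : V) : SimpleGraph V :=
  SimpleGraph.fromEdgeSet ((G.edgeSet \ {s(v, w), s(x, y)}) ∪ {s(v, x), s(w, y)})

/-- The four vertices can be switched. -/
structure Switchable (G : SimpleGraph V) (v w x y : V) : Prop where
  adj_vw : G.Adj v w
  adj_xy : G.Adj x y
  ne_vx : v ≠ x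
  ne_wy : w ≠ y
  not_vx : ¬ G.Adj v x
  not_wy : ¬ G.Adj w y

theorem switchEdges_symm₁ : switchEdges G w v y x = switchEdges G v w x y := by
  simp only [switchEdges, Sym2.eq_swap (a := w) (b := v), Sym2.eq_swap (a := y) (b := x),
    Set.pair_comm s(w, y)]

theorem switchEdges_symm₂ : switchEdges G x y v w = switchEdges G v w x y := by
  simp only [switchEdges, Sym2.eq_swap (a := x) (b := v), Sym2.eq_swap (a := y) (b := w),
    Set.pair_comm s(x, y)]

theorem Switchable.symm₁ (h : Switchable G v w x y) : Switchable G w v y x :=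
  ⟨h.adj_vw.symm, h.adj_xy.symm, h.ne_wy, h.ne_vx, h.not_wy, h.not_vx⟩

theorem Switchable.symm₂ (h : Switchable G v w x y) : Switchable G x y v w :=
  ⟨h.adj_xy, h.adj_vw, h.ne_vx.symm, h.ne_wy.symm, fun h' => h.not_vx h'.symm,
    fun h' => h.not_wy h'.symm⟩

theorem Switchable.switch_switch (h : Switchable G v w x y) :
    switchEdges (switchEdges G v w x y) v x w y = G := by
  obtain ⟨h1, h2, h3, h4, h5, h6⟩ := h
  ext a b
  have := @SimpleGraph.ne_of_adj V G a b
  have := h1.ne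
  have := h2.ne
  have := h1.symm
  have := h2.symm
  have : ¬ G.Adj x v := fun h => h5 h.symm
  have : ¬ G.Adj y w := fun h => h6 h.symm
  simp only [switchEdges, SimpleGraph.fromEdgeSet_adj, Set.mem_union, Set.mem_sdiff,
    Set.mem_insert_iff, Set.mem_singleton_iff, SimpleGraph.mem_edgeSet, Sym2.eq_iff]
  grind

variable [Fintype V] {d : ℕ} {G₀ : SimpleGraph V} {X : Finset V}

/-- The `d`-regular graphs that have the same neighbourhoods as `G₀` at all vertices of `X`. -/
noncomputable def regFamily (d : ℕ) (G₀ : SimpleGraph V) (X : Finset V) :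
    Finset (SimpleGraph V) :=
  (Set.toFinite {G : SimpleGraph V | (∀ v, #(nb G v) = d) ∧ ∀ x ∈ X, nb G x = nb G₀ x}).toFinset

theorem mem_regFamily :
    G ∈ regFamily d G₀ X ↔ (∀ v, #(nb G v) = d) ∧ ∀ x ∈ X, nb G x = nb G₀ x := by
  simp [regFamily]

theorem nb_switchEdges_of_ne {a : V} (hv : a ≠ v) (hw : a ≠ w) (hx : a ≠ x) (hy : a ≠ y) :
    nb (switchEdges G v w x y) a = nb G a := by
  ext b
  have := @SimpleGraph.ne_of_adj V G a b
  simp only [mem_nb, switchEdges, SimpleGraph.fromEdgeSet_adj, Set.mem_union, Set.mem_sdiff,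
    Set.mem_insert_iff, Set.mem_singleton_iff, SimpleGraph.mem_edgeSet, Sym2.eq_iff]
  grind

theorem Switchable.nb_v (h : Switchable G v w x y) :
    nb (switchEdges G v w x y) v = insert x ((nb G v).erase w) := by
  obtain ⟨h1, h2, h3, h4, h5, h6⟩ := h
  ext b
  have := @SimpleGraph.ne_of_adj V G v b
  have := h1.ne
  have := h2.ne
  simp only [mem_nb, switchEdges, SimpleGraph.fromEdgeSet_adj, Set.mem_union, Set.mem_sdiff,
    Set.mem_insert_iff, Set.mem_singleton_iff, SimpleGraph.mem_edgeSet, Sym2.eq_iff,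
    Finset.mem_insert, Finset.mem_erase]
  grind [SimpleGraph.Adj.symm]

theorem Switchable.card_nb_v (h : Switchable G v w x y) :
    #(nb (switchEdges G v w x y) v) = #(nb G v) := by
  rw [h.nb_v, Finset.card_insert_of_notMem (by simp [h.not_vx]),
    Finset.card_erase_add_one (by simp [h.adj_vw])]

theorem Switchable.card_nb (h : Switchable G v w x y) (a : V) :
    #(nb (switchEdges G v w x y) a) = #(nb G a) := by
  by_cases hv : a = v
  · subst hv; exact h.card_nb_v
  by_cases hw : a = w
  · subst hw; rw [← switchEdges_symm₁]; exact h.symm₁.card_nb_v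
  by_cases hx : a = x
  · subst hx; rw [← switchEdges_symm₂]; exact h.symm₂.card_nb_v
  by_cases hy : a = y
  · subst hy; rw [← switchEdges_symm₁, ← switchEdges_symm₂]; exact h.symm₁.symm₂.card_nb_v
  · rw [nb_switchEdges_of_ne hv hw hx hy]

/-- The pairs `(x, y)` for which `vw` can be switched with `xy` without touching `X`. -/
noncomputable def switchPairs (G : SimpleGraph V) (X : Finset V) (v w : V) : Finset (V × V) :=
  univ.filter fun q => G.Adj q.1 q.2 ∧ q.1 ∉ insert v (nb G v ∪ X) ∧ q.2 ∉ insert w (nb G w ∪ X)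

theorem card_adj_pairs_le (hG : ∀ v, #(nb G v) = d) (W : Finset V) :
    #(univ.filter fun q : V × V => G.Adj q.1 q.2 ∧ q.1 ∈ W) = #W * d := by
  have : (univ.filter fun q : V × V => G.Adj q.1 q.2 ∧ q.1 ∈ W) =
      (W.sigma fun a => nb G a).map (Equiv.sigmaEquivProd V V).toEmbedding := by
    ext ⟨a, b⟩
    simp [and_comm]
  rw [this, Finset.card_map, Finset.card_sigma, Finset.sum_congr rfl fun a _ => hG a]
  simp

/-- Start from all nd ordered edges and discard those whose first or second end is forbidden; each
forbidden set has at most #X + d + 1 vertices of degree d. -/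
theorem le_card_switchPairs (hG : ∀ v, #(nb G v) = d) :
    Fintype.card V * d ≤ #(switchPairs G X v w) + 2 * ((#X + d + 1) * d) := by
  have h1 := card_adj_pairs_le hG univ
  have h2 := card_adj_pairs_le hG (insert v (nb G v ∪ X))
  have h3 : #(univ.filter fun q : V × V => G.Adj q.1 q.2 ∧ q.2 ∈ insert w (nb G w ∪ X)) =
      #(insert w (nb G w ∪ X)) * d := by
    rw [← card_adj_pairs_le hG]
    refine Finset.card_bij (fun q _ => (q.2, q.1)) ?_ ?_ ?_
    · intro q hq
      simp only [Finset.mem_filter, Finset.mem_univ, true_and] at hq ⊢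
      exact ⟨hq.1.symm, hq.2⟩
    · rintro ⟨a, b⟩ _ ⟨a', b'⟩ _ h
      simp at h ⊢
      tauto
    · rintro ⟨a, b⟩ h
      simp only [Finset.mem_filter, Finset.mem_univ, true_and] at h
      exact ⟨(b, a), by simpa using ⟨h.1.symm, by simpa using h.2⟩, rfl⟩
  have h4 : ∀ u, #(insert u (nb G u ∪ X)) ≤ #X + d + 1 := fun u => by
    have := Finset.card_insert_le u (nb G u ∪ X)
    have := Finset.card_union_le (nb G u) X
    have := hG u
    omega
  have h5 : (univ.filter fun q : V × V => G.Adj q.1 q.2 ∧ q.1 ∈ univ) ⊆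
      switchPairs G X v w ∪ ((univ.filter fun q : V × V => G.Adj q.1 q.2 ∧
        q.1 ∈ insert v (nb G v ∪ X)) ∪ (univ.filter fun q : V × V => G.Adj q.1 q.2 ∧
        q.2 ∈ insert w (nb G w ∪ X))) := by
    intro q hq
    simp only [switchPairs, Finset.mem_union, Finset.mem_filter, Finset.mem_univ, true_and,
      and_true] at hq ⊢
    tauto
  have h6 := (Finset.card_le_card h5).trans (Finset.card_union_le _ _)
  have h7 := Finset.card_union_le (univ.filter fun q : V × V => G.Adj q.1 q.2 ∧
        q.1 ∈ insert v (nb G v ∪ X)) (univ.filter fun q : V × V => G.Adj q.1 q.2 ∧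
        q.2 ∈ insert w (nb G w ∪ X))
  have h8 := Nat.mul_le_mul_right d (h4 v)
  have h9 := Nat.mul_le_mul_right d (h4 w)
  rw [Finset.card_univ] at h1
  omega

/-- Double counting of switchings. Each graph containing vw admits at least m of them. The switched
graph together with (x, y) determines the original, and x, y are now neighbours of v, w, leaving at
most d² pairs per target graph. No neighbourhood of a vertex of X changes. -/
theorem card_adj_mul_le (hv : v ∉ X) (hw : w ∉ X) (m : ℕ)
    (hm : m + 2 * ((#X + d + 1) * d) ≤ Fintype.card V * d) :
    #((regFamily d G₀ X).filter fun G => G.Adj v w) * m ≤ #(regFamily d G₀ X) * (d * d) := by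
  set A := (regFamily d G₀ X).filter fun G => G.Adj v w
  have hA : ∀ G ∈ A, m ≤ #(switchPairs G X v w) := fun G hG => by
    have := le_card_switchPairs (X := X) (v := v) (w := w)
      (mem_regFamily.1 (Finset.mem_filter.1 hG).1).1
    omega
  have hsw : ∀ G ∈ A, ∀ q ∈ switchPairs G X v w, Switchable G v w q.1 q.2 := by
    intro G hG q hq
    simp only [switchPairs, Finset.mem_filter, Finset.mem_univ, true_and, Finset.mem_insert,
      Finset.mem_union, mem_nb, not_or] at hq
    exact ⟨(Finset.mem_filter.1 hG).2, hq.1, Ne.symm hq.2.1.1, Ne.symm hq.2.2.1, hq.2.1.2.1,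
      hq.2.2.2.1⟩
  calc #A * m ≤ ∑ G ∈ A, #(switchPairs G X v w) := by
        rw [← smul_eq_mul]
        exact Finset.card_nsmul_le_sum _ _ _ hA
    _ = #(A.sigma fun G => switchPairs G X v w) := (Finset.card_sigma _ _).symm
    _ ≤ #((regFamily d G₀ X).sigma fun G => nb G v ×ˢ nb G w) := by
        refine Finset.card_le_card_of_injOn
          (fun z => ⟨switchEdges z.1 v w z.2.1 z.2.2, z.2⟩) ?_ ?_
        · rintro ⟨G, q⟩ hz
          obtain ⟨hG, hq⟩ := Finset.mem_sigma.1 hz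
          have h := hsw G hG q hq
          have hG' := mem_regFamily.1 (Finset.mem_filter.1 hG).1
          simp only [switchPairs, Finset.mem_filter, Finset.mem_univ, true_and, Finset.mem_insert,
            Finset.mem_union, mem_nb, not_or] at hq
          refine Finset.mem_coe.2 (Finset.mem_sigma.2 ⟨mem_regFamily.2 ⟨fun a => ?_, ?_⟩, ?_⟩)
          · rw [h.card_nb, hG'.1]
          · intro a ha
            rw [nb_switchEdges_of_ne, hG'.2 a ha] <;> rintro rfl <;> tauto
          · rw [Finset.mem_product]
            refine ⟨?_, ?_⟩
            · dsimp only
              rw [h.nb_v]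
              simp
            · dsimp only
              rw [← switchEdges_symm₁, h.symm₁.nb_v]
              simp
        · rintro ⟨G, q⟩ hz ⟨G', q'⟩ hz' heq
          obtain ⟨hG, hq⟩ := Finset.mem_sigma.1 hz
          obtain ⟨hG', hq'⟩ := Finset.mem_sigma.1 hz'
          simp only [Sigma.mk.injEq, heq_eq_eq] at heq
          obtain ⟨h1, rfl⟩ := heq
          have h2 := (hsw G hG q hq).switch_switch
          rw [h1, (hsw G' hG' q hq').switch_switch] at h2
          rw [h2]
    _ = #(regFamily d G₀ X) * (d * d) := by
        rw [Finset.card_sigma, Finset.sum_congr rfl fun G hG => by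
          rw [Finset.card_product, (mem_regFamily.1 hG).1, (mem_regFamily.1 hG).1]]
        simp

/-- In a random regular graph with the neighbourhoods of a small set `X` prescribed, any two other
vertices are adjacent with probability `O(d / n)`. -/
theorem card_adj_le (hv : v ∉ X) (hw : w ∉ X) (hX : 16 * #X ≤ Fintype.card V)
    (hn : 16 ≤ Fintype.card V) :
    (#((regFamily d G₀ X).filter fun G => G.Adj v w) : ℝ) ≤
      16 * d / Fintype.card V * #(regFamily d G₀ X) := by
  have hn0 : (0 : ℝ) < Fintype.card V := by exact_mod_cast (by omega : 0 < Fintype.card V)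
  have hle : (#((regFamily d G₀ X).filter fun G => G.Adj v w) : ℝ) ≤ #(regFamily d G₀ X) := by
    exact_mod_cast Finset.card_filter_le _ _
  rw [div_mul_eq_mul_div, le_div_iff₀ hn0]
  -- For n ≤ 16d the factor 16d/n is at least 1 and the claim is trivial; otherwise X, d and 1 are
  -- each at most n/16, so enough switchings remain.
  rcases le_or_gt (Fintype.card V) (16 * d) with hd | hd
  · have hd' : (Fintype.card V : ℝ) ≤ 16 * d := by exact_mod_cast hd
    nlinarith [Nat.cast_nonneg (α := ℝ) (#(regFamily d G₀ X))]
  · rcases Nat.eq_zero_or_pos d with rfl | hd0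
    · have : (regFamily 0 G₀ X).filter (fun G => G.Adj v w) = ∅ := by
        rw [Finset.filter_eq_empty_iff]
        intro G hG hvw
        have := (mem_regFamily.1 hG).1 v
        rw [Finset.card_eq_zero] at this
        have h : w ∈ nb G v := mem_nb.2 hvw
        simp [this] at h
      simp [this]
    · obtain ⟨r, hr⟩ : ∃ r, 2 * (#X + d + 1) + r = Fintype.card V :=
        ⟨_, Nat.add_sub_cancel' (by omega)⟩
      have h1 := card_adj_mul_le (d := d) (G₀ := G₀) hv hw (r * d) (by rw [← hr]; nlinarith)
      have h2 : #((regFamily d G₀ X).filter fun G => G.Adj v w) * r ≤ #(regFamily d G₀ X) * d := by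
        refine Nat.le_of_mul_le_mul_right ?_ hd0
        nlinarith
      have h3 : Fintype.card V ≤ 16 * r := by omega
      have h2' : (#((regFamily d G₀ X).filter fun G => G.Adj v w) : ℝ) * r ≤
        #(regFamily d G₀ X) * d := by exact_mod_cast h2
      have h3' : (Fintype.card V : ℝ) ≤ 16 * r := by exact_mod_cast h3
      nlinarith [Nat.cast_nonneg (α := ℝ) (#((regFamily d G₀ X).filter fun G => G.Adj v w))]

end Switching

/-! ### One exploration step: mean, variance and two potentials -/

section OneStep

open scoped Classical
open Finset

variable {V : Type*} [Fintype V]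

/-- The number of neighbours of `a` in `X`. -/
noncomputable def hits (G : SimpleGraph V) (X : Finset V) (a : V) : ℕ := #(nb G a ∩ X)

/-- The normalised number of neighbours of `a` outside `X`. -/
noncomputable def wt (d : ℕ) (G : SimpleGraph V) (X : Finset V) (a : V) : ℝ :=
  ((d : ℝ) - hits G X a) / ((d : ℝ) - 1)

/-- The total weight of the active set. -/
noncomputable def actW (d : ℕ) (G : SimpleGraph V) (X U : Finset V) : ℝ := ∑ a ∈ U, wt d G X a

/-- The total weight that the active set has lost. -/
noncomputable def actL (d : ℕ) (G : SimpleGraph V) (X U : Finset V) : ℝ :=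
  ∑ a ∈ U, ((hits G X a : ℝ) - 1) / ((d : ℝ) - 1)

/-- A bound for the loss caused by the edges at `v` that lead to the active set or to vertices
which already have neighbours in `X`. -/
noncomputable def overlap (d : ℕ) (G : SimpleGraph V) (X U : Finset V) (v : V) : ℝ :=
  (#(nb G v ∩ U) + ∑ u ∈ nb G v \ X, (hits G X u : ℝ) / ((d : ℝ) - 1)) / ((d : ℝ) - 1)

/-- The weight that a retained neighbour `u` of the explored vertex contributes. -/
noncomputable def gain (d : ℕ) (G : SimpleGraph V) (X U : Finset V) (u : V) : ℝ :=
  if u ∈ U then 0 else 1 - (hits G X u : ℝ) / ((d : ℝ) - 1)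

variable {d : ℕ} {G : SimpleGraph V} {X U R : Finset V} {v : V}

theorem hits_insert (hv : v ∉ X) (a : V) :
    hits G (insert v X) a = hits G X a + if G.Adj v a then 1 else 0 := by
  unfold hits
  by_cases h : G.Adj v a
  · rw [Finset.inter_insert_of_mem (by simpa using h.symm), Finset.card_insert_of_notMem]
    · simp [h]
    · simp [hv]
  · rw [Finset.inter_insert_of_notMem (by simpa using fun h' => h h'.symm)]
    simp [h]

theorem hits_le (hG : ∀ v, #(nb G v) = d) (a : V) : hits G X a ≤ d :=
  (Finset.card_le_card Finset.inter_subset_left).trans (hG a).le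

theorem card_nb_sdiff (hG : ∀ v, #(nb G v) = d) (a : V) :
    (#(nb G a \ X) : ℝ) = d - hits G X a := by
  have := Finset.card_sdiff_add_card_inter (nb G a) X
  rw [hG a] at this
  have h : (#(nb G a \ X) : ℝ) + hits G X a = d := by exact_mod_cast this
  linarith

theorem one_lt_cast (hd : 3 ≤ d) : (2 : ℝ) ≤ (d : ℝ) - 1 := by
  have : (3 : ℝ) ≤ d := by exact_mod_cast hd
  linarith

theorem wt_nonneg (hd : 3 ≤ d) (hG : ∀ v, #(nb G v) = d) (a : V) : 0 ≤ wt d G X a := by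
  have h1 := one_lt_cast hd
  have h2 : (hits G X a : ℝ) ≤ d := by exact_mod_cast hits_le hG a
  exact div_nonneg (by linarith) (by linarith)

theorem wt_le (hd : 3 ≤ d) (a : V) : wt d G X a ≤ 3 / 2 := by
  have h1 := one_lt_cast hd
  have h2 : (0 : ℝ) ≤ hits G X a := Nat.cast_nonneg _
  rw [wt, div_le_iff₀ (by linarith)]
  linarith

theorem actW_nonneg (hd : 3 ≤ d) (hG : ∀ v, #(nb G v) = d) : 0 ≤ actW d G X U :=
  Finset.sum_nonneg fun a _ => wt_nonneg hd hG a

theorem actW_add_actL (hd : 3 ≤ d) : actW d G X U + actL d G X U = #U := by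
  have h1 := one_lt_cast hd
  rw [actW, actL, ← Finset.sum_add_distrib]
  have : ∀ a ∈ U, wt d G X a + ((hits G X a : ℝ) - 1) / ((d : ℝ) - 1) = 1 := fun a _ => by
    rw [wt]
    field_simp
    ring
  rw [Finset.sum_congr rfl this]
  simp

theorem sum_hits (hG : ∀ v, #(nb G v) = d) : ∑ u, hits G X u = #X * d := by
  have : ∀ u, hits G X u = ∑ x ∈ X, if G.Adj u x then 1 else 0 := fun u => by
    rw [Finset.sum_boole, hits]
    congr 1
    ext
    simp [and_comm]
  simp_rw [this]
  rw [Finset.sum_comm, Finset.sum_congr rfl fun x _ => ?_, Finset.sum_const, smul_eq_mul]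
  rw [Finset.sum_boole, ← hG x]
  norm_cast
  congr 1
  ext
  simp [SimpleGraph.adj_comm]

theorem actL_le (hd : 3 ≤ d) (hG : ∀ v, #(nb G v) = d) : actL d G X U ≤ 3 / 2 * #X := by
  have h1 := one_lt_cast hd
  have h2 : actL d G X U ≤ ∑ u, (hits G X u : ℝ) / ((d : ℝ) - 1) := by
    calc actL d G X U ≤ ∑ a ∈ U, (hits G X a : ℝ) / ((d : ℝ) - 1) :=
          Finset.sum_le_sum fun a _ => by gcongr; linarith
      _ ≤ _ := Finset.sum_le_sum_of_subset_of_nonneg (Finset.subset_univ _) fun a _ _ => by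
          positivity
  rw [← Finset.sum_div, ← Nat.cast_sum, sum_hits hG, Nat.cast_mul] at h2
  refine h2.trans ?_
  rw [div_le_iff₀ (by linarith)]
  nlinarith [Nat.cast_nonneg (α := ℝ) (#X)]

theorem overlap_nonneg (hd : 3 ≤ d) : 0 ≤ overlap d G X U v := by
  have h1 := one_lt_cast hd
  unfold overlap
  positivity

theorem sum_erase_union (hv : v ∉ X) (hR : R ⊆ nb G v \ X) (F : V → ℝ) :
    ∑ a ∈ U.erase v ∪ R, F a = ∑ a ∈ U.erase v, F a + ∑ u ∈ R, if u ∈ U then 0 else F u := by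
  have hvR : v ∉ R := fun h => by simpa using hR h
  have : U.erase v ∪ R = U.erase v ∪ R \ U := by
    ext a
    by_cases h : a = v
    · subst h; simp [hvR]
    · simp only [Finset.mem_union, Finset.mem_erase, Finset.mem_sdiff]; tauto
  rw [this, Finset.sum_union, Finset.sdiff_eq_filter, Finset.sum_filter]
  · congr 1
    exact Finset.sum_congr rfl fun u _ => by by_cases h : u ∈ U <;> simp [h]
  · exact Finset.disjoint_sdiff.mono_left (Finset.erase_subset _ _)

theorem sum_adj_erase (G : SimpleGraph V) (U : Finset V) (v : V) :
    ∑ a ∈ U.erase v, (if G.Adj v a then 1 else 0 : ℝ) = #(nb G v ∩ U) := by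
  rw [Finset.sum_boole]
  congr 2
  ext a
  simp only [Finset.mem_filter, Finset.mem_erase, Finset.mem_inter, mem_nb]
  have := @SimpleGraph.ne_of_adj V G v a
  grind

/-- Moving v into X costs every active neighbour of v one unexposed edge, that is 1/(d-1). A newly
active u has v as an additional hit, so its weight is 1 reduced only by its earlier hits. -/
theorem actW_step (hd : 3 ≤ d) (hv : v ∉ X) (hR : R ⊆ nb G v \ X) :
    actW d G (insert v X) (U.erase v ∪ R) =
      actW d G X (U.erase v) - #(nb G v ∩ U) / ((d : ℝ) - 1) + ∑ u ∈ R, gain d G X U u := by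
  have h1 := one_lt_cast hd
  rw [actW, sum_erase_union hv hR, actW, ← sum_adj_erase, Finset.sum_div, ← Finset.sum_sub_distrib]
  congr 1
  · refine Finset.sum_congr rfl fun a _ => ?_
    rw [wt, wt, hits_insert hv, ← sub_div]
    push_cast
    split_ifs <;> ring
  · refine Finset.sum_congr rfl fun u hu => ?_
    rw [gain]
    congr 1
    have : G.Adj v u := by simpa using (Finset.mem_sdiff.1 (hR hu)).1
    rw [wt, hits_insert hv, if_pos this]
    push_cast
    field_simp
    ring

theorem actL_step (hv : v ∉ X) (hR : R ⊆ nb G v \ X) :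
    actL d G (insert v X) (U.erase v ∪ R) =
      actL d G X (U.erase v) + #(nb G v ∩ U) / ((d : ℝ) - 1) +
        ∑ u ∈ R, if u ∈ U then 0 else (hits G X u : ℝ) / ((d : ℝ) - 1) := by
  rw [actL, sum_erase_union hv hR, actL, ← sum_adj_erase, Finset.sum_div, ← Finset.sum_add_distrib]
  congr 1
  · refine Finset.sum_congr rfl fun a _ => ?_
    rw [hits_insert hv, ← add_div]
    push_cast
    split_ifs <;> ring
  · refine Finset.sum_congr rfl fun u hu => ?_
    congr 1
    have : G.Adj v u := by simpa using (Finset.mem_sdiff.1 (hR hu)).1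
    rw [hits_insert hv, if_pos this]
    push_cast
    ring

/-- The retention probabilities near the percolation threshold. -/
structure NearCritical (d : ℕ) (p ε : ℝ) : Prop where
  three_le : 3 ≤ d
  abs_eps_le : |ε| ≤ 1 / 10
  eq : p * ((d : ℝ) - 1) = 1 + ε

variable {p ε : ℝ}

theorem NearCritical.nonneg (h : NearCritical d p ε) : 0 ≤ p := by
  have h1 := one_lt_cast h.three_le
  have h2 := abs_le.1 h.abs_eps_le
  have h3 := h.eq
  by_contra! h4
  nlinarith

theorem NearCritical.le (h : NearCritical d p ε) : p ≤ 11 / 20 := by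
  have h1 := one_lt_cast h.three_le
  have h2 := abs_le.1 h.abs_eps_le
  have h3 := h.eq
  have h4 := h.nonneg
  nlinarith

theorem NearCritical.mul_card (h : NearCritical d p ε) (hG : ∀ v, #(nb G v) = d) :
    p * #(nb G v \ X) = (1 + ε) * wt d G X v := by
  have h1 := one_lt_cast h.three_le
  rw [card_nb_sdiff hG, wt, ← h.eq]
  field_simp

theorem NearCritical.mul_card_le (h : NearCritical d p ε) (hG : ∀ v, #(nb G v) = d) :
    p * #(nb G v \ X) ≤ 2 := by
  have h2 := abs_le.1 h.abs_eps_le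
  rw [h.mul_card hG]
  nlinarith [wt_nonneg (X := X) h.three_le hG v, wt_le (G := G) (X := X) h.three_le v]

theorem gain_le_one (hd : 3 ≤ d) (u : V) : gain d G X U u ≤ 1 := by
  have h1 := one_lt_cast hd
  unfold gain
  split_ifs
  · norm_num
  · have : 0 ≤ (hits G X u : ℝ) / ((d : ℝ) - 1) := by positivity
    linarith

theorem sum_gain_ge (hd : 3 ≤ d) (hUX : Disjoint U X) :
    (#(nb G v \ X) : ℝ) - ((d : ℝ) - 1) * overlap d G X U v ≤
      ∑ u ∈ nb G v \ X, gain d G X U u := by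
  have h1 := one_lt_cast hd
  have h2 : (#(nb G v ∩ U) : ℝ) = ∑ u ∈ nb G v \ X, if u ∈ U then 1 else 0 := by
    rw [Finset.sum_boole]
    congr 2
    ext a
    simp only [Finset.mem_inter, Finset.mem_filter, Finset.mem_sdiff]
    have : a ∈ U → a ∉ X := fun h => Finset.disjoint_left.1 hUX h
    tauto
  rw [overlap, mul_div_cancel₀ _ (by linarith), h2, ← Finset.sum_add_distrib,
    Finset.card_eq_sum_ones, Nat.cast_sum, ← Finset.sum_sub_distrib]
  refine Finset.sum_le_sum fun u _ => ?_
  have : 0 ≤ (hits G X u : ℝ) / ((d : ℝ) - 1) := by positivity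
  unfold gain
  split_ifs <;> push_cast <;> linarith

/-- The conditional mean of the weight of the active set after exploring `v`. -/
noncomputable def stepMean (d : ℕ) (p : ℝ) (G : SimpleGraph V) (X U : Finset V) (v : V) : ℝ :=
  actW d G X (U.erase v) - #(nb G v ∩ U) / ((d : ℝ) - 1) + p * ∑ u ∈ nb G v \ X, gain d G X U u

theorem card_inter_div_le (hd : 3 ≤ d) :
    (#(nb G v ∩ U) : ℝ) / ((d : ℝ) - 1) ≤ overlap d G X U v := by
  have h1 := one_lt_cast hd
  unfold overlap
  gcongr
  have : 0 ≤ ∑ u ∈ nb G v \ X, (hits G X u : ℝ) / ((d : ℝ) - 1) := by positivity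
  linarith

theorem NearCritical.mul_overlap_le (h : NearCritical d p ε) :
    p * (((d : ℝ) - 1) * overlap d G X U v) ≤ 11 / 10 * overlap d G X U v := by
  have h2 := abs_le.1 h.abs_eps_le
  rw [← mul_assoc, h.eq]
  exact mul_le_mul_of_nonneg_right (by linarith) (overlap_nonneg h.three_le)

/-- The weight of v is replaced by 1 + ε times itself. The overlap is charged once for active
neighbours losing an edge and at most 11/10 times for the reduced gains. -/
theorem stepMean_ge (h : NearCritical d p ε) (hG : ∀ v, #(nb G v) = d) (hUX : Disjoint U X) :
    actW d G X (U.erase v) + (1 + ε) * wt d G X v - 3 * overlap d G X U v ≤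
      stepMean d p G X U v := by
  have h1 := mul_le_mul_of_nonneg_left (sum_gain_ge (G := G) (v := v) h.three_le hUX) h.nonneg
  have h2 := card_inter_div_le (G := G) (X := X) (U := U) (v := v) h.three_le
  have h3 := h.mul_overlap_le (G := G) (X := X) (U := U) (v := v)
  have h4 := overlap_nonneg (G := G) (X := X) (U := U) (v := v) h.three_le
  rw [mul_sub, h.mul_card hG] at h1
  unfold stepMean
  linarith

/-- Since g² ≥ 2g - 1, the squared gains are bounded below by the gains themselves. The constant 2/5
comes from 1 + ε ≥ 9/10 and 1 - p ≥ 9/20, the latter because d ≥ 3. -/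
theorem stepVar_ge (h : NearCritical d p ε) (hG : ∀ v, #(nb G v) = d) (hUX : Disjoint U X) :
    2 / 5 * wt d G X v - 3 * overlap d G X U v ≤
      p * (1 - p) * ∑ u ∈ nb G v \ X, gain d G X U u ^ 2 := by
  have h1 := mul_le_mul_of_nonneg_left (sum_gain_ge (G := G) (v := v) h.three_le hUX) h.nonneg
  have h3 := h.mul_overlap_le (G := G) (X := X) (U := U) (v := v)
  have h4 := overlap_nonneg (G := G) (X := X) (U := U) (v := v) h.three_le
  have h5 : 2 * ∑ u ∈ nb G v \ X, gain d G X U u - #(nb G v \ X) ≤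
      ∑ u ∈ nb G v \ X, gain d G X U u ^ 2 := by
    rw [Finset.card_eq_sum_ones, Nat.cast_sum, Finset.mul_sum, ← Finset.sum_sub_distrib]
    refine Finset.sum_le_sum fun u _ => ?_
    push_cast
    nlinarith [sq_nonneg (gain d G X U u - 1)]
  have h6 := mul_le_mul_of_nonneg_left h5 h.nonneg
  have h7 := h.mul_card (X := X) (v := v) hG
  have h8 := wt_nonneg (X := X) h.three_le hG v
  have h9 := abs_le.1 h.abs_eps_le
  have h10 := h.le
  have h11 := h.nonneg
  have h12 : 9 / 10 * wt d G X v - 22 / 10 * overlap d G X U v ≤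
      p * ∑ u ∈ nb G v \ X, gain d G X U u ^ 2 := by nlinarith
  have h13 : 0 ≤ ∑ u ∈ nb G v \ X, gain d G X U u ^ 2 := Finset.sum_nonneg fun _ _ => sq_nonneg _
  calc _ ≤ (1 - p) * (9 / 10 * wt d G X v - 22 / 10 * overlap d G X U v) := by nlinarith
    _ ≤ (1 - p) * (p * ∑ u ∈ nb G v \ X, gain d G X U u ^ 2) :=
        mul_le_mul_of_nonneg_left h12 (by linarith)
    _ = _ := by ring

theorem bexp_actW (h : NearCritical d p ε) (hv : v ∉ X) :
    bexp p (nb G v \ X) (fun R => actW d G (insert v X) (U.erase v ∪ R)) =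
      stepMean d p G X U v := by
  rw [bexp_congr fun R hR => actW_step h.three_le hv hR, bexp_add_sum, stepMean]

theorem bexp_actW_sq (h : NearCritical d p ε) (hv : v ∉ X) :
    bexp p (nb G v \ X) (fun R => actW d G (insert v X) (U.erase v ∪ R) ^ 2) =
      stepMean d p G X U v ^ 2 + p * (1 - p) * ∑ u ∈ nb G v \ X, gain d G X U u ^ 2 := by
  rw [bexp_congr fun R hR => by rw [actW_step h.three_le hv hR], bexp_add_sum_sq, stepMean]

theorem bexp_actL_le (h : NearCritical d p ε) (hv : v ∉ X) :
    bexp p (nb G v \ X) (fun R => actL d G (insert v X) (U.erase v ∪ R)) ≤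
      actL d G X (U.erase v) + 3 * overlap d G X U v := by
  have h0 := one_lt_cast h.three_le
  rw [bexp_congr fun R hR => actL_step hv hR, bexp_add_sum]
  have h1 : (∑ u ∈ nb G v \ X, if u ∈ U then 0 else (hits G X u : ℝ) / ((d : ℝ) - 1)) ≤
      ((d : ℝ) - 1) * overlap d G X U v := by
    rw [overlap, mul_div_cancel₀ _ (by linarith)]
    have : (∑ u ∈ nb G v \ X, if u ∈ U then 0 else (hits G X u : ℝ) / ((d : ℝ) - 1)) ≤
        ∑ u ∈ nb G v \ X, (hits G X u : ℝ) / ((d : ℝ) - 1) :=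
      Finset.sum_le_sum fun u _ => by
        split_ifs
        · positivity
        · exact le_rfl
    have : (0 : ℝ) ≤ #(nb G v ∩ U) := Nat.cast_nonneg _
    linarith
  have h2 := mul_le_mul_of_nonneg_left h1 h.nonneg
  have h3 := h.mul_overlap_le (G := G) (X := X) (U := U) (v := v)
  have h4 := overlap_nonneg (G := G) (X := X) (U := U) (v := v) h.three_le
  have h5 := card_inter_div_le (G := G) (X := X) (U := U) (v := v) h.three_le
  linarith

theorem actW_erase_le (hd : 3 ≤ d) (hG : ∀ v, #(nb G v) = d) :
    actW d G X (U.erase v) ≤ actW d G X U :=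
  Finset.sum_le_sum_of_subset_of_nonneg (Finset.erase_subset _ _) fun a _ _ => wt_nonneg hd hG a

theorem actW_le_erase_add (hd : 3 ≤ d) :
    actW d G X U ≤ actW d G X (U.erase v) + 3 / 2 := by
  by_cases h : v ∈ U
  · have h1 := Finset.sum_erase_add U (wt d G X) h
    have h2 := wt_le (G := G) (X := X) hd v
    unfold actW
    linarith
  · rw [Finset.erase_eq_of_notMem h]
    linarith

theorem actW_step_le (hd : 3 ≤ d) (hG : ∀ v, #(nb G v) = d) (hv : v ∉ X) (hR : R ⊆ nb G v \ X) :
    actW d G (insert v X) (U.erase v ∪ R) ≤ actW d G X U + #R := by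
  have h0 := one_lt_cast hd
  rw [actW_step hd hv hR]
  have h1 := actW_erase_le (X := X) (U := U) (v := v) hd hG
  have h2 : 0 ≤ (#(nb G v ∩ U) : ℝ) / ((d : ℝ) - 1) := by positivity
  have h3 : ∑ u ∈ R, gain d G X U u ≤ #R := by
    simpa using Finset.sum_le_card_nsmul R (gain d G X U) 1 fun u _ => gain_le_one hd u
  linarith

theorem le_actW_step (hd : 3 ≤ d) (hG : ∀ v, #(nb G v) = d) (hv : v ∉ X) (hR : R ⊆ nb G v \ X) :
    actW d G X U - 3 - #R ≤ actW d G (insert v X) (U.erase v ∪ R) := by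
  have h0 := one_lt_cast hd
  rw [actW_step hd hv hR]
  have h1 := actW_le_erase_add (G := G) (X := X) (U := U) (v := v) hd
  have h2 : (#(nb G v ∩ U) : ℝ) / ((d : ℝ) - 1) ≤ 3 / 2 := by
    rw [div_le_iff₀ (by linarith)]
    have : #(nb G v ∩ U) ≤ d := (Finset.card_le_card Finset.inter_subset_left).trans (hG v).le
    have : (#(nb G v ∩ U) : ℝ) ≤ d := by exact_mod_cast this
    linarith
  have h3 : -(#R : ℝ) ≤ ∑ u ∈ R, gain d G X U u := by
    have : ∀ u ∈ R, (-1 : ℝ) ≤ gain d G X U u := fun u _ => by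
      unfold gain
      split_ifs
      · norm_num
      · have : (hits G X u : ℝ) / ((d : ℝ) - 1) ≤ 2 := by
          rw [div_le_iff₀ (by linarith)]
          have : (hits G X u : ℝ) ≤ d := by exact_mod_cast hits_le hG u
          linarith
        linarith
    simpa using Finset.card_nsmul_le_sum R (gain d G X U) (-1) this
  linarith

/-- The truncated parabola that measures the distance of the weight to the level `H`. -/
noncomputable def climb (H y : ℝ) : ℝ := max (4 * H ^ 2 - y ^ 2) 0

/-- The squared distance below the level `H`. -/
noncomputable def fall (H y : ℝ) : ℝ := max (H - y) 0 ^ 2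

/-- The variance makes the parabola decrease; drift and overlap cost at most 2H times their size.
Truncation at 0 matters only after a jump past 2H, which costs 4 · 63/H = 252/H. If U is empty, the
old weight is 0 and the squared mean cannot lie below it. -/
theorem bexp_climb_le {H : ℝ} (h : NearCritical d p ε) (hG : ∀ v, #(nb G v) = d) (hv : v ∉ X)
    (hUX : Disjoint U X) (hvU : v ∈ U ∨ U = ∅) (hH : 1 ≤ H) (hY : actW d G X U ≤ H) :
    bexp p (nb G v \ X) (fun R => climb H (actW d G (insert v X) (U.erase v ∪ R))) ≤
      climb H (actW d G X U) + 2 * H * (3 / 2 * |ε| + 3 * overlap d G X U v) +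
        3 * overlap d G X U v + 252 / H - 2 / 5 * wt d G X v := by
  have hd := h.three_le
  have hY0 : 0 ≤ actW d G X U := actW_nonneg hd hG
  have hpt : ∀ R ⊆ nb G v \ X, climb H (actW d G (insert v X) (U.erase v ∪ R)) ≤
      (4 * H ^ 2 + (-1) * actW d G (insert v X) (U.erase v ∪ R) ^ 2) +
        4 / H * (#R : ℝ) ^ 3 := by
    intro R hR
    have h1 := actW_step_le (U := U) hd hG hv hR
    have h0 : 0 ≤ actW d G (insert v X) (U.erase v ∪ R) := actW_nonneg hd hG
    set y := actW d G (insert v X) (U.erase v ∪ R)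
    set r := (#R : ℝ)
    have hr : 0 ≤ r := Nat.cast_nonneg _
    have h2 : 0 ≤ 4 / H * r ^ 3 := by positivity
    refine max_le (by linarith) ?_
    -- Beyond 2H the jump satisfies r ≥ H, so y ≤ H + r ≤ 2r and the deficit y² - 4H² is at most 4r²
    -- ≤ 4r³/H.
    rcases le_or_gt y (2 * H) with hy | hy
    · nlinarith
    · have h3 : H ≤ r := by linarith
      have h4 : 4 * r ^ 2 ≤ 4 / H * r ^ 3 := by
        rw [div_mul_eq_mul_div, le_div_iff₀ (by linarith)]
        nlinarith [mul_nonneg hr hr]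
      nlinarith
  have h1 := bexp_mono h.nonneg (by linarith [h.le]) hpt
  rw [bexp_add, bexp_add, bexp_const, bexp_const_mul, bexp_const_mul, bexp_actW_sq h hv] at h1
  have h2 := bexp_card_cube_le h.nonneg (by linarith [h.le]) (h.mul_card_le (X := X) (v := v) hG)
  have h3 : 4 / H * bexp p (nb G v \ X) (fun R => (#R : ℝ) ^ 3) ≤ 252 / H := by
    calc _ ≤ 4 / H * 63 := mul_le_mul_of_nonneg_left h2 (by positivity)
      _ = _ := by ring
  have h4 := stepVar_ge h hG hUX (v := v)
  have h5 : 4 * H ^ 2 - actW d G X U ^ 2 ≤ climb H (actW d G X U) := le_max_left _ _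
  have hS := overlap_nonneg (G := G) (X := X) (U := U) (v := v) h.three_le
  have h6 : actW d G X U ^ 2 - 2 * H * (3 / 2 * |ε| + 3 * overlap d G X U v) ≤
      stepMean d p G X U v ^ 2 := by
    have hc : 0 ≤ 3 / 2 * |ε| + 3 * overlap d G X U v := by positivity
    rcases hvU with hvU | rfl
    · have h7 := stepMean_ge h hG hUX (v := v)
      have h8 : actW d G X (U.erase v) + wt d G X v = actW d G X U :=
        Finset.sum_erase_add U _ hvU
      have h9 : -(3 / 2 * |ε|) ≤ ε * wt d G X v := by
        have := wt_nonneg (X := X) hd hG v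
        have := wt_le (G := G) (X := X) hd v
        nlinarith [neg_abs_le ε, abs_nonneg ε]
      have h10 : -(3 / 2 * |ε| + 3 * overlap d G X U v) ≤ stepMean d p G X U v - actW d G X U := by
        linarith
      nlinarith [sq_nonneg (stepMean d p G X U v - actW d G X U)]
    · have : actW d G X ∅ = 0 := by simp [actW]
      rw [this]
      nlinarith [sq_nonneg (stepMean d p G X ∅ v)]
  linarith

/-- With m the current shortfall and δ the increment, the new value is at most (m - δ)². The linear
term is controlled by the drift; |δ| ≤ 3 + #R gives δ² ≤ 18 + 2(#R)³, and 18 + 2 · 63 = 144. -/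
theorem bexp_fall_le {H : ℝ} (h : NearCritical d p ε) (hG : ∀ v, #(nb G v) = d) (hv : v ∉ X)
    (hUX : Disjoint U X) (hvU : v ∈ U) :
    bexp p (nb G v \ X) (fun R => fall H (actW d G (insert v X) (U.erase v ∪ R))) ≤
      fall H (actW d G X U) + 2 * max (H - actW d G X U) 0 *
        (3 / 2 * |ε| + 3 * overlap d G X U v) + 144 := by
  have hd := h.three_le
  set m := max (H - actW d G X U) 0
  have hm : 0 ≤ m := le_max_right _ _
  have hpt : ∀ R ⊆ nb G v \ X, fall H (actW d G (insert v X) (U.erase v ∪ R)) ≤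
      (fall H (actW d G X U) + 2 * m * actW d G X U + 18 +
        (-2 * m) * actW d G (insert v X) (U.erase v ∪ R)) + 2 * (#R : ℝ) ^ 3 := by
    intro R hR
    have h1 := actW_step_le (U := U) hd hG hv hR
    have h2 := le_actW_step (U := U) hd hG hv hR
    set y := actW d G (insert v X) (U.erase v ∪ R)
    set y₀ := actW d G X U
    have h3 : (#R : ℝ) ^ 2 ≤ (#R : ℝ) ^ 3 := by
      have : (#R) ^ 2 ≤ (#R) ^ 3 := by
        rcases Nat.eq_zero_or_pos (#R) with h | h
        · simp [h]
        · exact Nat.pow_le_pow_right h (by norm_num)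
      exact_mod_cast this
    set r := (#R : ℝ)
    have hr : 0 ≤ r := Nat.cast_nonneg _
    have h4 : (y - y₀) ^ 2 ≤ 18 + 2 * r ^ 2 := by
      have : (y - y₀) ^ 2 ≤ (3 + r) ^ 2 := by
        apply sq_le_sq'
        · linarith
        · linarith
      nlinarith [sq_nonneg (r - 3)]
    have h5 : fall H y ≤ (m - (y - y₀)) ^ 2 := by
      unfold fall
      rcases le_total (H - y) 0 with h' | h'
      · rw [max_eq_right h']
        nlinarith [sq_nonneg (m - (y - y₀))]
      · rw [max_eq_left h']
        have : H - y₀ ≤ m := le_max_left _ _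
        exact pow_le_pow_left₀ h' (by linarith) 2
    have h6 : fall H y₀ = m ^ 2 := rfl
    nlinarith
  have h1 := bexp_mono h.nonneg (by linarith [h.le]) hpt
  rw [bexp_add, bexp_add, bexp_const, bexp_const_mul, bexp_const_mul, bexp_actW h hv] at h1
  have h2 := bexp_card_cube_le h.nonneg (by linarith [h.le]) (h.mul_card_le (X := X) (v := v) hG)
  have h7 := stepMean_ge h hG hUX (v := v)
  have h8 : actW d G X (U.erase v) + wt d G X v = actW d G X U :=
    Finset.sum_erase_add U _ hvU
  have h9 : -(3 / 2 * |ε|) ≤ ε * wt d G X v := by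
    have := wt_nonneg (X := X) hd hG v
    have := wt_le (G := G) (X := X) hd v
    nlinarith [neg_abs_le ε, abs_nonneg ε]
  have h10 : -(3 / 2 * |ε| + 3 * overlap d G X U v) ≤ stepMean d p G X U v - actW d G X U := by
    linarith
  have h11 := mul_le_mul_of_nonneg_left h10 hm
  linarith

end OneStep

/-! ### Lower tail: climbing to a level and surviving there -/

section LowerBound

open scoped Classical
open Finset

variable {V : Type*} [Fintype V] {d : ℕ} {G G₀ : SimpleGraph V} {X U R : Finset V} {v : V}
  {p ε : ℝ}

/-- Edges into X are already revealed. So all weights are constant on the family and act as known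
quantities when averaging over it. -/
theorem hits_eq_of_mem (hG : G ∈ regFamily d G₀ X) (a : V) : hits G X a = hits G₀ X a := by
  unfold hits
  congr 1
  ext x
  simp only [Finset.mem_inter, mem_nb]
  refine and_congr_left fun hx => ?_
  have := Finset.ext_iff.1 ((mem_regFamily.1 hG).2 x hx) a
  rw [mem_nb, mem_nb] at this
  rw [G.adj_comm, this, G₀.adj_comm]

theorem wt_eq_of_mem (hG : G ∈ regFamily d G₀ X) (a : V) : wt d G X a = wt d G₀ X a := by
  rw [wt, wt, hits_eq_of_mem hG]

theorem actW_eq_of_mem (hG : G ∈ regFamily d G₀ X) (U : Finset V) :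
    actW d G X U = actW d G₀ X U :=
  Finset.sum_congr rfl fun a _ => wt_eq_of_mem hG a

theorem actL_eq_of_mem (hG : G ∈ regFamily d G₀ X) (U : Finset V) :
    actL d G X U = actL d G₀ X U :=
  Finset.sum_congr rfl fun a _ => by rw [hits_eq_of_mem hG]

/-- By linearity, every possible neighbour of v outside X costs an adjacency probability 16d/n,
while its hits in X are fixed and sum to at most d · #X. Here 24 = 16 · 3/2, using d/(d-1) ≤ 3/2. -/
theorem sum_overlap_le (hd : 3 ≤ d) (hG₀ : ∀ v, #(nb G₀ v) = d) (hv : v ∉ X)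
    (hUX : Disjoint U X) (hX : 16 * #X ≤ Fintype.card V) (hn : 16 ≤ Fintype.card V) :
    ∑ G ∈ regFamily d G₀ X, overlap d G X U v ≤
      #(regFamily d G₀ X) * (24 / Fintype.card V * (#U + 3 / 2 * #X)) := by
  have h1 := one_lt_cast hd
  have hn0 : (0 : ℝ) < Fintype.card V := by exact_mod_cast (by omega : 0 < Fintype.card V)
  set F := regFamily d G₀ X
  set D : ℝ := (d : ℝ) - 1
  set c : ℝ := 16 * d / Fintype.card V * #F
  have hc : 0 ≤ c := by positivity
  have hA : ∀ u, u ∉ X → ∑ G ∈ F, (if G.Adj v u then 1 else 0 : ℝ) ≤ c := fun u hu => by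
    rw [Finset.sum_boole]
    exact card_adj_le hv hu hX hn
  have hov : ∀ G ∈ F, overlap d G X U v = (∑ u ∈ U, (if G.Adj v u then 1 else 0 : ℝ) +
      ∑ u ∈ univ \ X, (if G.Adj v u then 1 else 0 : ℝ) * ((hits G₀ X u : ℝ) / D)) / D := by
    intro G hG
    unfold overlap
    congr 2
    · rw [Finset.sum_boole]
      congr 2
      ext
      simp [and_comm]
    · have : nb G v \ X = (univ \ X).filter (fun u => G.Adj v u) := by
        ext
        simp [and_comm]
      rw [this, Finset.sum_filter]
      refine Finset.sum_congr rfl fun u _ => ?_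
      rw [hits_eq_of_mem hG]
      split_ifs <;> simp [D]
  rw [Finset.sum_congr rfl hov, ← Finset.sum_div, Finset.sum_add_distrib, Finset.sum_comm,
    Finset.sum_comm (s := F)]
  have hB : ∑ u ∈ U, ∑ G ∈ F, (if G.Adj v u then 1 else 0 : ℝ) ≤ #U * c := by
    simpa using Finset.sum_le_card_nsmul U _ c fun u hu => hA u (Finset.disjoint_left.1 hUX hu)
  have hC : ∑ u ∈ univ \ X, ∑ G ∈ F, (if G.Adj v u then 1 else 0 : ℝ) * ((hits G₀ X u : ℝ) / D) ≤
      c * (3 / 2 * #X) := by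
    calc _ ≤ ∑ u ∈ univ \ X, c * ((hits G₀ X u : ℝ) / D) := by
          refine Finset.sum_le_sum fun u hu => ?_
          rw [← Finset.sum_mul]
          exact mul_le_mul_of_nonneg_right (hA u (by simpa using hu)) (by positivity)
      _ ≤ ∑ u, c * ((hits G₀ X u : ℝ) / D) :=
          Finset.sum_le_sum_of_subset_of_nonneg (Finset.subset_univ _) fun u _ _ => by positivity
      _ = c * (((#X * d : ℕ) : ℝ) / D) := by
          rw [← Finset.mul_sum, ← Finset.sum_div, ← Nat.cast_sum, sum_hits hG₀]
      _ ≤ _ := by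
          refine mul_le_mul_of_nonneg_left ?_ hc
          rw [div_le_iff₀ (by linarith)]
          push_cast
          have : (d : ℝ) ≤ 3 / 2 * D := by simp only [D] at h1 ⊢; linarith
          nlinarith [Nat.cast_nonneg (α := ℝ) (#X)]
  have hD : (d : ℝ) ≤ 3 / 2 * D := by simp only [D] at h1 ⊢; linarith
  rw [div_le_iff₀ (by linarith)]
  calc _ ≤ c * (#U + 3 / 2 * #X) := by linarith
    _ = d * (16 / Fintype.card V * #F * (#U + 3 / 2 * #X)) := by simp only [c]; ring
    _ ≤ 3 / 2 * D * (16 / Fintype.card V * #F * (#U + 3 / 2 * #X)) :=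
        mul_le_mul_of_nonneg_right hD (by positivity)
    _ = _ := by ring

theorem sum_add_mul_overlap_le {H : ℝ} {T : ℕ} (hd : 3 ≤ d) (hG₀ : ∀ v, #(nb G₀ v) = d)
    (hv : v ∉ X) (hUX : Disjoint U X) (hT : 16 * T ≤ Fintype.card V) (hXT : #X ≤ T)
    (hn : 16 ≤ Fintype.card V) (hY : actW d G₀ X U ≤ H) (A : ℝ) {B : ℝ} (hB : 0 ≤ B) :
    ∑ G ∈ regFamily d G₀ X, (A + B * overlap d G X U v) ≤
      #(regFamily d G₀ X) * (A + B * (24 / Fintype.card V * (H + 3 * T))) := by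
  have h1 := sum_overlap_le hd hG₀ hv hUX (by omega) hn
  -- The size of U is its weight plus its lost weight, and the loss is paid for by edges from X.
  have hU : (#U : ℝ) ≤ H + 3 / 2 * #X := by
    have := actW_add_actL (G := G₀) (X := X) (U := U) hd
    have := actL_le (X := X) (U := U) hd hG₀
    linarith
  have hXT' : (#X : ℝ) ≤ T := by exact_mod_cast hXT
  have h2 : (24 / Fintype.card V * (#U + 3 / 2 * #X) : ℝ) ≤
      24 / Fintype.card V * (H + 3 * T) :=
    mul_le_mul_of_nonneg_left (by linarith) (by positivity)
  rw [Finset.sum_add_distrib, Finset.sum_const, nsmul_eq_mul, ← Finset.mul_sum, mul_add]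
  have h3 := h1.trans (mul_le_mul_of_nonneg_left h2 (Nat.cast_nonneg _))
  have h4 := mul_le_mul_of_nonneg_left h3 hB
  linarith

/-- Averaging first over the graphs with a prescribed neighbourhood of `v`. -/
theorem sum_bexp_nb_le (h0 : 0 ≤ p) (h1 : p ≤ 1) (v : V)
    {a b : SimpleGraph V → Finset V → ℝ}
    (hb : ∀ G ∈ regFamily d G₀ X, ∀ G' ∈ regFamily d G (insert v X), ∀ R, b G' R = b G R)
    (hab : ∀ G ∈ regFamily d G₀ X, ∀ R ⊆ nb G v \ X,
      ∑ G' ∈ regFamily d G (insert v X), a G' R ≤ #(regFamily d G (insert v X)) * b G R) :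
    ∑ G ∈ regFamily d G₀ X, bexp p (nb G v \ X) (a G) ≤
      ∑ G ∈ regFamily d G₀ X, bexp p (nb G v \ X) (b G) := by
  have hmaps : ∀ G ∈ regFamily d G₀ X, nb G v ∈ (univ : Finset (Finset V)) := by simp
  rw [← Finset.sum_fiberwise_of_maps_to hmaps, ← Finset.sum_fiberwise_of_maps_to hmaps]
  refine Finset.sum_le_sum fun N _ => ?_
  rcases Finset.eq_empty_or_nonempty ((regFamily d G₀ X).filter fun G => nb G v = N) with he | he
  · rw [he]
    simp
  obtain ⟨G, hGN⟩ := he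
  obtain ⟨hG, rfl⟩ := Finset.mem_filter.1 hGN
  have hfib : (regFamily d G₀ X).filter (fun G' => nb G' v = nb G v) =
      regFamily d G (insert v X) := by
    ext G'
    simp only [Finset.mem_filter, mem_regFamily, Finset.mem_insert, forall_eq_or_imp]
    have hG2 := (mem_regFamily.1 hG).2
    constructor
    · rintro ⟨⟨h2, h3⟩, h4⟩
      exact ⟨h2, h4, fun x hx => (h3 x hx).trans (hG2 x hx).symm⟩
    · rintro ⟨h2, h4, h3⟩
      exact ⟨⟨h2, fun x hx => (h3 x hx).trans (hG2 x hx)⟩, h4⟩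
  rw [hfib]
  have hnb : ∀ G' ∈ regFamily d G (insert v X), nb G' v = nb G v := fun G' hG' =>
    (mem_regFamily.1 hG').2 v (by simp)
  calc ∑ G' ∈ regFamily d G (insert v X), bexp p (nb G' v \ X) (a G')
      = bexp p (nb G v \ X) fun R => ∑ G' ∈ regFamily d G (insert v X), a G' R := by
        rw [bexp_sum]
        exact Finset.sum_congr rfl fun G' hG' => by rw [hnb G' hG']
    _ ≤ bexp p (nb G v \ X) fun R => ∑ G' ∈ regFamily d G (insert v X), b G' R := by
        refine bexp_mono h0 h1 fun R hR => (hab G hG R hR).trans_eq ?_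
        rw [Finset.sum_congr rfl fun G' hG' => hb G hG G' hG' R]
        simp
    _ = _ := by
        rw [bexp_sum]
        exact Finset.sum_congr rfl fun G' hG' => by rw [hnb G' hG']

theorem disjoint_step (hUX : Disjoint U X) (hR : R ⊆ nb G v \ X) :
    Disjoint (U.erase v ∪ R) (insert v X) := by
  rw [Finset.disjoint_left]
  intro a ha
  rw [Finset.mem_insert, not_or]
  rcases Finset.mem_union.1 ha with ha | ha
  · exact ⟨Finset.ne_of_mem_erase ha,
      Finset.disjoint_left.1 hUX (Finset.mem_of_mem_erase ha)⟩
  · have := Finset.mem_sdiff.1 (hR ha)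
    exact ⟨(G.ne_of_adj (mem_nb.1 this.1)).symm, this.2⟩

theorem indicator_le_indicator {P Q : Prop} [Decidable P] [Decidable Q] (h : P → Q) :
    (if P then 1 else 0 : ℝ) ≤ if Q then 1 else 0 := by
  by_cases hP : P
  · simp [hP, h hP]
  · rw [if_neg hP]
    split_ifs <;> norm_num

theorem percExp_indicator_le_one (h0 : 0 ≤ p) (h1 : p ≤ 1) (P : SimpleGraph V → Prop)
    [DecidablePred P] :
    percExp p G X (fun K => if P K then 1 else 0) ≤ 1 := by
  calc _ ≤ percExp p G X (fun _ => 1) :=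
        percExp_mono h0 h1 fun K _ => by split_ifs <;> norm_num
    _ = 1 := percExp_const 1

theorem percExp_indicator_mono (h0 : 0 ≤ p) (h1 : p ≤ 1) {P Q : SimpleGraph V → Prop}
    [DecidablePred P] [DecidablePred Q] (h : ∀ K, P K → Q K) :
    percExp p G X (fun K => if P K then 1 else 0) ≤ percExp p G X (fun K => if Q K then 1 else 0) :=
  percExp_mono h0 h1 fun K _ => indicator_le_indicator (h K)

/-- A large active set is unlikely to die out soon. -/
theorem sum_percExp_clus_lt_le {H : ℝ} {T : ℕ} (h : NearCritical d p ε) (hH : 0 < H)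
    (hT : 16 * T ≤ Fintype.card V) (hn : 16 ≤ Fintype.card V)
    (hdrift : 2 * H * (3 / 2 * |ε| + 3 * (24 / Fintype.card V * (H + 3 * T))) ≤ 1) (m : ℕ) :
    ∀ (G₀ : SimpleGraph V) (X U : Finset V), (∀ v, #(nb G₀ v) = d) → #X + m ≤ T → Disjoint U X →
      ∑ G ∈ regFamily d G₀ X, percExp p G X (fun K => if #(clus K U) < m then 1 else 0) ≤
        #(regFamily d G₀ X) * ((fall H (actW d G₀ X U) + 145 * m) / H ^ 2) := by
  have hp1 : p ≤ 1 := by linarith [h.le]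
  have hfall : ∀ y, 0 ≤ fall H y := fun y => sq_nonneg _
  induction m with
  | zero =>
    intro G₀ X U _ _ _
    have : ∀ G ∈ regFamily d G₀ X,
        percExp p G X (fun K => if #(clus K U) < 0 then (1 : ℝ) else 0) = 0 := fun G _ => by
      simpa using percExp_const 0
    rw [Finset.sum_congr rfl this]
    simp only [Finset.sum_const_zero]
    have := hfall (actW d G₀ X U)
    positivity
  | succ m ih =>
    intro G₀ X U hG₀ hXT hUX
    rcases U.eq_empty_or_nonempty with rfl | ⟨v, hvU⟩
    -- Extinction means weight 0, where the shortfall is H² and the claimed bound exceeds 1.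
    · have h1 : (1 : ℝ) ≤ (fall H (actW d G₀ X ∅) + 145 * (m + 1 : ℕ)) / H ^ 2 := by
        rw [le_div_iff₀ (by positivity)]
        have : fall H (actW d G₀ X ∅) = H ^ 2 := by simp [fall, actW, hH.le]
        rw [this]
        have : (0 : ℝ) ≤ (m + 1 : ℕ) := Nat.cast_nonneg _
        linarith
      calc _ ≤ ∑ G ∈ regFamily d G₀ X, (1 : ℝ) :=
            Finset.sum_le_sum fun G _ => percExp_indicator_le_one h.nonneg hp1 _
        _ = #(regFamily d G₀ X) * 1 := by simp
        _ ≤ _ := mul_le_mul_of_nonneg_left h1 (Nat.cast_nonneg _)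
    · have hv : v ∉ X := Finset.disjoint_left.1 hUX hvU
      set M := max (H - actW d G₀ X U) 0 with hM
      have hM0 : 0 ≤ M := le_max_right _ _
      set Y₀ := actW d G₀ X U with hY₀
      have hY0 : 0 ≤ Y₀ := actW_nonneg h.three_le hG₀
      calc _ ≤ ∑ G ∈ regFamily d G₀ X, bexp p (nb G v \ X) fun R =>
            percExp p G (insert v X)
              (fun K => if #(clus K (U.erase v ∪ R)) < m then 1 else 0) := by
            refine Finset.sum_le_sum fun G _ => ?_
            rw [percExp_expose hv]
            refine bexp_mono h.nonneg hp1 fun R hR => percExp_mono h.nonneg hp1 fun K hK => ?_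
            rw [card_clus_sup_starGraph hvU (fun hvR => by simpa using hR hvR)
              (hK v (by simp))]
            simp
        _ ≤ ∑ G ∈ regFamily d G₀ X, bexp p (nb G v \ X) fun R =>
            (fall H (actW d G (insert v X) (U.erase v ∪ R)) + 145 * m) / H ^ 2 := by
            refine sum_bexp_nb_le h.nonneg hp1 v ?_ ?_
            · intro G _ G' hG' R
              rw [actW_eq_of_mem hG']
            · intro G hG R hR
              refine ih G _ _ (mem_regFamily.1 hG).1 ?_ (disjoint_step hUX hR)
              have := Finset.card_insert_le v X
              omega
        _ ≤ ∑ G ∈ regFamily d G₀ X,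
            ((fall H Y₀ + 144 + 145 * m + 2 * M * (3 / 2 * |ε|)) / H ^ 2 +
              6 * M / H ^ 2 * overlap d G X U v) := by
            refine Finset.sum_le_sum fun G hG => ?_
            have h1 := bexp_fall_le (H := H) h (mem_regFamily.1 hG).1 hv hUX hvU
            rw [actW_eq_of_mem hG, ← hY₀, ← hM] at h1
            have h2 : bexp p (nb G v \ X) (fun R =>
                (fall H (actW d G (insert v X) (U.erase v ∪ R)) + 145 * m) / H ^ 2) =
                1 / H ^ 2 * (bexp p (nb G v \ X)
                  (fun R => fall H (actW d G (insert v X) (U.erase v ∪ R))) + 145 * m) := by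
              rw [← bexp_const (p := p) (E := nb G v \ X) (145 * (m : ℝ)), ← bexp_add,
                ← bexp_const_mul]
              exact bexp_congr fun R _ => by rw [bexp_const]; ring
            rw [h2]
            have h3 : 0 ≤ 1 / H ^ 2 := by positivity
            calc _ ≤ 1 / H ^ 2 * ((fall H Y₀ + 2 * M * (3 / 2 * |ε| + 3 * overlap d G X U v) +
                  144) + 145 * m) := mul_le_mul_of_nonneg_left (by linarith) h3
              _ = _ := by ring
        _ ≤ _ := by
            -- Below H the drift term is at most 1, turning 144 into 145. Above H the shortfall M
            -- vanishes and with it the overlap term, so no bound on #U is needed.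
            rcases le_or_gt Y₀ H with hYH | hYH
            · refine (sum_add_mul_overlap_le (T := T) (H := H) h.three_le hG₀ hv hUX hT (by omega)
                hn hYH _ (by positivity)).trans (mul_le_mul_of_nonneg_left ?_ (Nat.cast_nonneg _))
              have hMH : M ≤ H := max_le (by linarith) hH.le
              have hκ : 0 ≤ 3 / 2 * |ε| + 3 * (24 / Fintype.card V * (H + 3 * T)) := by positivity
              have h5 : 2 * M * (3 / 2 * |ε| + 3 * (24 / Fintype.card V * (H + 3 * T))) ≤ 1 :=
                le_trans (mul_le_mul_of_nonneg_right (by linarith) hκ) hdrift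
              rw [div_mul_eq_mul_div (6 * M), ← add_div]
              refine div_le_div_of_nonneg_right ?_ (by positivity)
              push_cast
              linarith
            · have hM0' : M = 0 := max_eq_right (by linarith)
              rw [hM0']
              simp only [mul_zero, zero_mul, zero_div, add_zero, Finset.sum_const, nsmul_eq_mul]
              refine mul_le_mul_of_nonneg_left (div_le_div_of_nonneg_right ?_ (by positivity))
                (Nat.cast_nonneg _)
              push_cast
              linarith

theorem actL_nonneg (hd : 3 ≤ d) (hU : ∀ a ∈ U, 1 ≤ hits G X a) : 0 ≤ actL d G X U := by
  have h1 := one_lt_cast hd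
  refine Finset.sum_nonneg fun a ha => div_nonneg ?_ (by linarith)
  have : (1 : ℝ) ≤ hits G X a := by exact_mod_cast hU a ha
  linarith

/-- Otherwise every vertex outside X would have at least half of its edges going to X, more edges
than the few vertices of X can supply. -/
theorem exists_half_le_wt (hd : 3 ≤ d) (hG : ∀ v, #(nb G v) = d)
    (hX : 16 * #X ≤ Fintype.card V) (hn : 16 ≤ Fintype.card V) :
    ∃ v ∉ X, 1 / 2 ≤ wt d G X v := by
  by_contra! hcon
  have h1 := one_lt_cast hd
  have h2 : ∀ v ∈ univ \ X, d ≤ 2 * hits G X v := by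
    intro v hv
    have h3 := hcon v (by simpa using hv)
    rw [wt, div_lt_iff₀ (by linarith)] at h3
    have : (d : ℝ) ≤ 2 * hits G X v := by linarith
    exact_mod_cast this
  have h3 := Finset.card_nsmul_le_sum _ _ _ h2
  have h4 : ∑ v ∈ univ \ X, 2 * hits G X v ≤ 2 * (#X * d) := by
    rw [← Finset.mul_sum, ← sum_hits hG]
    exact Nat.mul_le_mul_left _ (Finset.sum_le_sum_of_subset (Finset.subset_univ _))
  have h5 : #(univ \ X) + #X = Fintype.card V := by
    rw [Finset.card_sdiff_add_card_eq_card (Finset.subset_univ _), Finset.card_univ]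
  rw [smul_eq_mul] at h3
  have h6 : #(univ \ X) * d ≤ 2 * #X * d := by linarith
  have h7 := Nat.le_of_mul_le_mul_right h6 (by omega)
  omega

set_option maxHeartbeats 400000 in
/-- The exploration reaches a high level with high probability, and afterwards it survives for
a long time. -/
theorem sum_percExp_all_clus_lt_le {H : ℝ} {T T₁ k : ℕ} (h : NearCritical d p ε) (hH : 1 ≤ H)
    (hT : 16 * T ≤ Fintype.card V) (hn : 16 ≤ Fintype.card V) (hT₁ : 0 < T₁) (hk : T₁ + k ≤ T)
    (hdrift : 2 * H * (3 / 2 * |ε| + 3 * (24 / Fintype.card V * (H + 3 * T))) +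
      3 * (24 / Fintype.card V * (H + 3 * T)) + 252 / H ≤ 1 / 20) (j : ℕ) :
    ∀ (G₀ : SimpleGraph V) (X U : Finset V), (∀ v, #(nb G₀ v) = d) → #X + j = T₁ →
      Disjoint U X → (∀ a ∈ U, 1 ≤ hits G₀ X a) →
      ∑ G ∈ regFamily d G₀ X,
        percExp p G X (fun K => if #(clus K U) < k ∧ ∀ w, #(clus K {w}) < k then 1 else 0) ≤
        #(regFamily d G₀ X) * ((#X + 20 * climb H (actW d G₀ X U) + 6 * actL d G₀ X U) / T₁ +
          145 * k / H ^ 2) := by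
  have hp1 : p ≤ 1 := by linarith [h.le]
  have hd := h.three_le
  have hclimb : ∀ y, 0 ≤ climb H y := fun y => le_max_right _ _
  have hT₁' : (0 : ℝ) < T₁ := by exact_mod_cast hT₁
  set κ : ℝ := 24 / Fintype.card V * (H + 3 * T) with hκ
  have hκ0 : 0 ≤ κ := by positivity
  have hH252 : 0 ≤ 252 / H := by positivity
  have hHκ : 0 ≤ 2 * H * (3 / 2 * |ε|) := by positivity
  have hκ1 : κ ≤ 1 / 60 := by nlinarith
  induction j with
  | zero =>
    intro G₀ X U hG₀ hXT hUX hU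
    -- The time budget is spent: #X = T₁ alone makes the bound at least 1.
    have h1 : (1 : ℝ) ≤ (#X + 20 * climb H (actW d G₀ X U) + 6 * actL d G₀ X U) / T₁ +
          145 * k / H ^ 2 := by
      have h2 : (1 : ℝ) ≤ (#X + 20 * climb H (actW d G₀ X U) + 6 * actL d G₀ X U) / T₁ := by
        rw [le_div_iff₀ hT₁', ← hXT]
        push_cast
        linarith [hclimb (actW d G₀ X U), actL_nonneg hd hU]
      have h3 : 0 ≤ 145 * k / H ^ 2 := by positivity
      linarith
    calc _ ≤ ∑ G ∈ regFamily d G₀ X, (1 : ℝ) :=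
          Finset.sum_le_sum fun G _ => percExp_indicator_le_one h.nonneg hp1 _
      _ = #(regFamily d G₀ X) * 1 := by simp
      _ ≤ _ := mul_le_mul_of_nonneg_left h1 (Nat.cast_nonneg _)
  | succ j ih =>
    intro G₀ X U hG₀ hXT hUX hU
    set Y₀ := actW d G₀ X U with hY₀
    have hL0 : 0 ≤ actL d G₀ X U := actL_nonneg hd hU
    -- Once the level is reached, the survival estimate takes over with zero shortfall.
    rcases le_or_gt H Y₀ with hYH | hYH
    · have hdrift' : 2 * H * (3 / 2 * |ε| + 3 * κ) ≤ 1 := by linarith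
      have h1 := sum_percExp_clus_lt_le h (by linarith) hT hn hdrift' k G₀ X U hG₀ (by omega) hUX
      have h2 : fall H (actW d G₀ X U) = 0 := by
        rw [fall, max_eq_right (by linarith)]
        norm_num
      rw [h2, zero_add] at h1
      calc _ ≤ ∑ G ∈ regFamily d G₀ X,
            percExp p G X (fun K => if #(clus K U) < k then 1 else 0) := by
            exact Finset.sum_le_sum fun G _ => percExp_indicator_mono h.nonneg hp1 fun K hK => hK.1
        _ ≤ _ := h1
        _ ≤ _ := by
            refine mul_le_mul_of_nonneg_left ?_ (Nat.cast_nonneg _)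
            have := hclimb Y₀
            have : 0 ≤ (#X + 20 * climb H Y₀ + 6 * actL d G₀ X U) / T₁ := by positivity
            linarith
    · obtain ⟨v, hv, hvU, hvw⟩ : ∃ v ∉ X, (v ∈ U ∨ U = ∅) ∧ (v ∈ U ∨ 1 / 2 ≤ wt d G₀ X v) := by
        rcases U.eq_empty_or_nonempty with rfl | ⟨v, hvU⟩
        · obtain ⟨v, hv, hvw⟩ := exists_half_le_wt (X := X) hd hG₀ (by omega) hn
          exact ⟨v, hv, Or.inr rfl, Or.inr hvw⟩
        · exact ⟨v, Finset.disjoint_left.1 hUX hvU, Or.inl hvU, Or.inl hvU⟩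
      set L₀ := actL d G₀ X (U.erase v) with hL₀
      -- The potential must absorb the time step 1 and errors of at most 1 + 18κ ≤ 1.3. If v has
      -- weight at least 1/2, the parabola yields 20 · 2/5 · 1/2 = 4. If not, v is active and
      -- removing it lowers the lost weight by at least 1/2, which yields 3; this is the purpose of
      -- the term `6 * actL`.
      have hgoal : (#X + 1 : ℝ) + 20 * (climb H Y₀ + 2 * H * (3 / 2 * |ε|) + 252 / H -
          2 / 5 * wt d G₀ X v) + 6 * L₀ + (120 * H + 78) * κ ≤
          #X + 20 * climb H Y₀ + 6 * actL d G₀ X U := by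
        have hwt := wt_nonneg (X := X) hd hG₀ v
        by_cases hvU' : v ∈ U
        · have hL1 : L₀ + ((hits G₀ X v : ℝ) - 1) / ((d : ℝ) - 1) = actL d G₀ X U :=
            Finset.sum_erase_add U _ hvU'
          have hd1 := one_lt_cast hd
          have hl0 : 0 ≤ ((hits G₀ X v : ℝ) - 1) / ((d : ℝ) - 1) := by
            refine div_nonneg ?_ (by linarith)
            have : (1 : ℝ) ≤ hits G₀ X v := by exact_mod_cast hU v hvU'
            linarith
          have hlw : wt d G₀ X v + ((hits G₀ X v : ℝ) - 1) / ((d : ℝ) - 1) = 1 := by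
            rw [wt]
            field_simp
            ring
          rcases le_or_gt (1 / 2) (wt d G₀ X v) with hw | hw <;> nlinarith
        · have hw := hvw.resolve_left hvU'
          have : L₀ = actL d G₀ X U := by rw [hL₀, Finset.erase_eq_of_notMem hvU']
          rw [this]
          nlinarith
      calc _ ≤ ∑ G ∈ regFamily d G₀ X, bexp p (nb G v \ X) fun R =>
            percExp p G (insert v X) (fun K => if #(clus K (U.erase v ∪ R)) < k ∧
              ∀ w, #(clus K {w}) < k then 1 else 0) := by
            refine Finset.sum_le_sum fun G _ => ?_
            rw [percExp_expose hv]
            refine bexp_mono h.nonneg hp1 fun R hR => percExp_mono h.nonneg hp1 fun K hK => ?_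
            have hvR : v ∉ R := fun hvR => by simpa using hR hvR
            have himp : (#(clus (K ⊔ starGraph v R) U) < k ∧
                ∀ w, #(clus (K ⊔ starGraph v R) {w}) < k) →
                (#(clus K (U.erase v ∪ R)) < k ∧ ∀ w, #(clus K {w}) < k) := by
              rintro ⟨h1, h2⟩
              refine ⟨?_, fun w => (Finset.card_le_card
                (clus_mono le_sup_left (Finset.Subset.refl _))).trans_lt (h2 w)⟩
              -- On a restart the bound on single clusters is applied to v, whose cluster is v
              -- together with the cluster of R.
              rcases hvU with hvU | rfl
              · rw [card_clus_sup_starGraph hvU hvR (hK v (by simp))] at h1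
                omega
              · have h3 := h2 v
                rw [card_clus_sup_starGraph (by simp) hvR (hK v (by simp))] at h3
                simp only [Finset.erase_singleton, Finset.erase_empty] at h3 ⊢
                omega
            exact indicator_le_indicator himp
        _ ≤ ∑ G ∈ regFamily d G₀ X, bexp p (nb G v \ X) fun R =>
            (((#X + 1 : ℝ) + 20 * climb H (actW d G (insert v X) (U.erase v ∪ R)) +
              6 * actL d G (insert v X) (U.erase v ∪ R)) / T₁ + 145 * k / H ^ 2) := by
            refine sum_bexp_nb_le (a := fun G R => percExp p G (insert v X)
                (fun K => if #(clus K (U.erase v ∪ R)) < k ∧ ∀ w, #(clus K {w}) < k then 1 else 0))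
              (b := fun G R => ((#X + 1 : ℝ) +
                20 * climb H (actW d G (insert v X) (U.erase v ∪ R)) +
                6 * actL d G (insert v X) (U.erase v ∪ R)) / T₁ + 145 * k / H ^ 2)
              h.nonneg hp1 v ?_ ?_
            · intro G _ G' hG' R
              rw [actW_eq_of_mem hG', actL_eq_of_mem hG']
            · intro G hG R hR
              have hcard := Finset.card_insert_of_notMem hv
              refine (ih G _ _ (mem_regFamily.1 hG).1 (by omega) (disjoint_step hUX hR)
                ?_).trans_eq ?_
              · intro a ha
                rw [hits_insert hv]
                rcases Finset.mem_union.1 ha with ha | ha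
                · rw [hits_eq_of_mem hG]
                  have := hU a (Finset.mem_of_mem_erase ha)
                  omega
                · have : G.Adj v a := mem_nb.1 (Finset.mem_sdiff.1 (hR ha)).1
                  simp [this]
              · rw [hcard]
                push_cast
                rfl
        _ ≤ ∑ G ∈ regFamily d G₀ X,
            ((((#X + 1 : ℝ) + 20 * (climb H Y₀ + 2 * H * (3 / 2 * |ε|) + 252 / H -
              2 / 5 * wt d G₀ X v) + 6 * L₀) / T₁ + 145 * k / H ^ 2) +
              (120 * H + 78) / T₁ * overlap d G X U v) := by
            refine Finset.sum_le_sum fun G hG => ?_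
            have hGr := (mem_regFamily.1 hG).1
            have hYG : actW d G X U = Y₀ := actW_eq_of_mem hG U
            have h1 := bexp_climb_le h hGr hv hUX hvU hH (hYG.le.trans hYH.le)
            rw [hYG, wt_eq_of_mem hG] at h1
            have h2 := bexp_actL_le (G := G) (U := U) h hv
            rw [actL_eq_of_mem hG, ← hL₀] at h2
            have h3 : bexp p (nb G v \ X) (fun R =>
                (((#X + 1 : ℝ) + 20 * climb H (actW d G (insert v X) (U.erase v ∪ R)) +
                  6 * actL d G (insert v X) (U.erase v ∪ R)) / T₁ + 145 * k / H ^ 2)) =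
                ((#X + 1 : ℝ) + 20 * bexp p (nb G v \ X)
                  (fun R => climb H (actW d G (insert v X) (U.erase v ∪ R))) +
                  6 * bexp p (nb G v \ X)
                    (fun R => actL d G (insert v X) (U.erase v ∪ R))) / T₁ +
                  145 * k / H ^ 2 := by
              have e : ∀ R : Finset V,
                  (((#X + 1 : ℝ) + 20 * climb H (actW d G (insert v X) (U.erase v ∪ R)) +
                  6 * actL d G (insert v X) (U.erase v ∪ R)) / T₁ + 145 * k / H ^ 2) =
                  ((#X + 1 : ℝ) / T₁ + 145 * k / H ^ 2) +
                    (20 / T₁ * climb H (actW d G (insert v X) (U.erase v ∪ R)) +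
                    6 / T₁ * actL d G (insert v X) (U.erase v ∪ R)) := fun R => by ring
              simp only [e]
              rw [bexp_add, bexp_const, bexp_add, bexp_const_mul, bexp_const_mul]
              ring
            rw [h3]
            calc _ ≤ ((#X + 1 : ℝ) + 20 * (climb H Y₀ + 2 * H * (3 / 2 * |ε| +
                  3 * overlap d G X U v) + 3 * overlap d G X U v + 252 / H -
                  2 / 5 * wt d G₀ X v) + 6 * (L₀ + 3 * overlap d G X U v)) / T₁ +
                  145 * k / H ^ 2 := by gcongr
              _ = _ := by ring
        _ ≤ _ := by
            refine (sum_add_mul_overlap_le (T := T) (H := H) hd hG₀ hv hUX hT (by omega)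
                hn hYH.le _ (by positivity)).trans (mul_le_mul_of_nonneg_left ?_ (Nat.cast_nonneg _))
            rw [← hκ]
            have := (div_le_div_iff_of_pos_right hT₁').2 hgoal
            rw [add_div _ ((120 * H + 78) * κ)] at this
            rw [div_mul_eq_mul_div (120 * H + 78)]
            linarith

/-- In a random regular graph, near the threshold, all percolation clusters are small only with
small probability. -/
theorem sum_percExp_small_le {H : ℝ} {T T₁ k : ℕ} (h : NearCritical d p ε) (hH : 1 ≤ H)
    (hT : 16 * T ≤ Fintype.card V) (hn : 16 ≤ Fintype.card V) (hT₁ : 0 < T₁) (hk : T₁ + k ≤ T)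
    (hk0 : 0 < k)
    (hdrift : 2 * H * (3 / 2 * |ε| + 3 * (24 / Fintype.card V * (H + 3 * T))) +
      3 * (24 / Fintype.card V * (H + 3 * T)) + 252 / H ≤ 1 / 20)
    (hG₀ : ∀ v, #(nb G₀ v) = d) :
    ∑ G ∈ regFamily d G₀ ∅, percExp p G ∅ (fun K => if ∀ w, #(clus K {w}) < k then 1 else 0) ≤
      #(regFamily d G₀ ∅) * (80 * H ^ 2 / T₁ + 145 * k / H ^ 2) := by
  have h1 := sum_percExp_all_clus_lt_le h hH hT hn hT₁ hk hdrift T₁ G₀ ∅ ∅ hG₀ (by simp) (by simp)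
    (by simp)
  have h2 : climb H 0 = 4 * H ^ 2 := by
    rw [climb, max_eq_left] <;> nlinarith
  simp only [clus_empty, Finset.card_empty, hk0, true_and, actW, actL, Finset.sum_empty, h2] at h1
  refine h1.trans_eq ?_
  push_cast
  ring

end LowerBound

/-! ### Upper tail: comparison with a branching process -/

section UpperBound

open scoped Classical
open Finset

variable {V : Type*} [Fintype V] {d : ℕ} {G : SimpleGraph V} {X U R : Finset V} {v : V}
  {p ε s y : ℝ}

/-- A lower bound for the generating function of the cluster size in terms of a subsolution of the
fixed point equation of the dominating branching process. -/
theorem pow_card_le_percExp (h : NearCritical d p ε) (hG : ∀ v, #(nb G v) = d) (hs : 0 ≤ s)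
    (hy0 : 0 ≤ y) (hy1 : y ≤ 1) (hsy : 1 - y ≤ s * (1 - p * y) ^ (d - 1)) (j : ℕ) :
    ∀ X U : Finset V, #X + j = Fintype.card V → Disjoint U X → (∀ a ∈ U, 1 ≤ hits G X a) →
      (1 - y) ^ #U ≤ percExp p G X (fun K => s ^ #(clus K U)) := by
  have hp0 := h.nonneg
  have hp1 : p ≤ 1 := by linarith [h.le]
  have hpy : 0 ≤ 1 - p * y ∧ 1 - p * y ≤ 1 := by constructor <;> nlinarith
  induction j with
  | zero =>
    intro X U hX hUX _
    have hXu : X = univ := by rwa [add_zero, Finset.card_eq_iff_eq_univ] at hX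
    have hU : U = ∅ := by
      rw [hXu] at hUX
      exact Finset.eq_empty_of_forall_notMem fun a ha =>
        Finset.disjoint_left.1 hUX ha (Finset.mem_univ a)
    subst hU
    simp [clus_empty, percExp_const]
  | succ j ih =>
    intro X U hX hUX hU
    rcases U.eq_empty_or_nonempty with rfl | ⟨v, hvU⟩
    · simp [clus_empty, percExp_const]
    have hv : v ∉ X := Finset.disjoint_left.1 hUX hvU
    -- An active vertex has a neighbour in X, so it has at most d - 1 potential children.
    have hN : #(nb G v \ X) ≤ d - 1 := by
      have h1 := Finset.card_sdiff_add_card_inter (nb G v) X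
      have h2 : 1 ≤ #(nb G v ∩ X) := hU v hvU
      have h3 := hG v
      omega
    have hcU : #(U.erase v) + 1 = #U := Finset.card_erase_add_one hvU
    calc (1 - y) ^ #U = (1 - y) ^ #(U.erase v) * (1 - y) := by rw [← hcU, pow_succ]
      _ ≤ (1 - y) ^ #(U.erase v) * (s * (1 - p * y) ^ #(nb G v \ X)) := by
          refine mul_le_mul_of_nonneg_left (hsy.trans ?_) (pow_nonneg (by linarith) _)
          exact mul_le_mul_of_nonneg_left (pow_le_pow_of_le_one hpy.1 hpy.2 hN) hs
      _ = bexp p (nb G v \ X) (fun R => s * (1 - y) ^ #(U.erase v) * (1 - y) ^ #R) := by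
          rw [bexp_const_mul, bexp_pow_card, show 1 - p + p * (1 - y) = 1 - p * y by ring]
          ring
      _ ≤ bexp p (nb G v \ X) (fun R =>
            s * percExp p G (insert v X) (fun K => s ^ #(clus K (U.erase v ∪ R)))) := by
          refine bexp_mono hp0 hp1 fun R hR => ?_
          rw [mul_assoc]
          refine mul_le_mul_of_nonneg_left ?_ hs
          refine le_trans ?_ (ih (insert v X) (U.erase v ∪ R) ?_ ?_ ?_)
          · rw [← pow_add]
            exact pow_le_pow_of_le_one (by linarith) (by linarith) (Finset.card_union_le _ _)
          · rw [Finset.card_insert_of_notMem hv]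
            omega
          · rw [Finset.disjoint_left]
            intro a ha
            rw [Finset.mem_insert, not_or]
            rcases Finset.mem_union.1 ha with ha | ha
            · exact ⟨Finset.ne_of_mem_erase ha,
                Finset.disjoint_left.1 hUX (Finset.mem_of_mem_erase ha)⟩
            · have := Finset.mem_sdiff.1 (hR ha)
              exact ⟨(G.ne_of_adj (mem_nb.1 this.1)).symm, this.2⟩
          · intro a ha
            rw [hits_insert hv]
            rcases Finset.mem_union.1 ha with ha | ha
            · have := hU a (Finset.mem_of_mem_erase ha)
              omega
            · have : G.Adj v a := mem_nb.1 (Finset.mem_sdiff.1 (hR ha)).1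
              simp [this]
      _ ≤ _ := by
          rw [percExp_expose hv]
          refine bexp_mono hp0 hp1 fun R hR => ?_
          rw [← percExp_const_mul]
          refine percExp_mono hp0 hp1 fun K hK => ?_
          rw [card_clus_sup_starGraph hvU (fun hvR => by simpa using hR hvR) (hK v (by simp)),
            pow_succ, mul_comm]

/-- The root alone has d potential children. The extra factor 1 - py ≥ 1 - y turns 1 - y into at
least 1 - 2y. -/
theorem one_sub_le_percExp (h : NearCritical d p ε) (hG : ∀ v, #(nb G v) = d) (hs : 0 ≤ s)
    (hy0 : 0 ≤ y) (hy1 : y ≤ 1) (hsy : 1 - y ≤ s * (1 - p * y) ^ (d - 1)) (v : V) :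
    1 - 2 * y ≤ percExp p G ∅ (fun K => s ^ #(clus K {v})) := by
  have hp0 := h.nonneg
  have hp1 : p ≤ 1 := by linarith [h.le]
  have hd := h.three_le
  have hpy : 0 ≤ 1 - p * y ∧ 1 - y ≤ 1 - p * y := by constructor <;> nlinarith
  calc 1 - 2 * y ≤ (1 - y) * (1 - p * y) := by nlinarith
    _ ≤ (s * (1 - p * y) ^ (d - 1)) * (1 - p * y) := mul_le_mul_of_nonneg_right hsy hpy.1
    _ = s * (1 - p * y) ^ #(nb G v \ ∅) := by
        rw [mul_assoc, ← pow_succ, Finset.sdiff_empty, hG, Nat.sub_add_cancel (by omega)]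
    _ = bexp p (nb G v \ ∅) (fun R => s * (1 - y) ^ #R) := by
        rw [bexp_const_mul, bexp_pow_card, show 1 - p + p * (1 - y) = 1 - p * y by ring]
    _ ≤ _ := by
        rw [percExp_expose (v := v) (by simp)]
        refine bexp_mono hp0 hp1 fun R hR => ?_
        have hvR : v ∉ R := fun hvR => by simpa using hR hvR
        have hpos : 0 < Fintype.card V := Fintype.card_pos_iff.2 ⟨v⟩
        refine (mul_le_mul_of_nonneg_left (pow_card_le_percExp h hG hs hy0 hy1 hsy
          (Fintype.card V - 1) (insert v ∅) R ?_ (by simpa using hvR) ?_) hs).trans ?_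
        · simp only [insert_empty_eq, Finset.card_singleton]
          omega
        · intro a ha
          have : G.Adj v a := mem_nb.1 (Finset.mem_sdiff.1 (hR ha)).1
          rw [hits_insert (by simp)]
          simp [this]
        · rw [← percExp_const_mul]
          refine percExp_mono hp0 hp1 fun K hK => ?_
          rw [card_clus_sup_starGraph (by simp) hvR (hK v (by simp)), pow_succ, mul_comm]
          simp

theorem clus_singleton_eq {K : SimpleGraph V} {u w : V} (h : u ∈ clus K {w}) :
    clus K {u} = clus K {w} := by
  have h' : K.Reachable w u := by simpa using h
  ext x
  simp only [mem_clus, Finset.mem_singleton, exists_eq_left]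
  exact ⟨fun hx => h'.trans hx, fun hx => h'.symm.trans hx⟩

/-- In a regular graph, near the threshold, the expected number of vertices in large clusters is
small. -/
theorem percExp_exists_large_le (h : NearCritical d p ε) (hG : ∀ v, #(nb G v) = d) (hs : 0 ≤ s)
    (hs1 : s ≤ 1) (hy0 : 0 ≤ y) (hy1 : y ≤ 1) (hsy : 1 - y ≤ s * (1 - p * y) ^ (d - 1)) (m : ℕ) :
    percExp p G ∅ (fun K => if ∃ w, m ≤ #(clus K {w}) then 1 else 0) * (m * (1 - s ^ m)) ≤
      2 * y * Fintype.card V := by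
  have hp0 := h.nonneg
  have hp1 : p ≤ 1 := by linarith [h.le]
  have hterm : ∀ k, 0 ≤ 1 - s ^ k := fun k => sub_nonneg.2 (pow_le_one₀ hs hs1)
  calc _ = percExp p G ∅ (fun K => (m * (1 - s ^ m)) *
          if ∃ w, m ≤ #(clus K {w}) then 1 else 0) := by
        rw [percExp_const_mul, mul_comm]
    _ ≤ percExp p G ∅ (fun K => ∑ v, (1 + (-1) * s ^ #(clus K {v}))) := by
        refine percExp_mono hp0 hp1 fun K _ => ?_
        have hnn : ∀ v, 0 ≤ 1 + (-1) * s ^ #(clus K {v}) := fun v => by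
          linarith [hterm #(clus K {v})]
        split_ifs with hw
        -- A single large cluster contributes at least m vertices, each with a summand of at least 1
        -- - s^m.
        · obtain ⟨w, hw⟩ := hw
          calc _ = (m : ℝ) * (1 - s ^ m) := mul_one _
            _ ≤ #(clus K {w}) * (1 - s ^ m) :=
                mul_le_mul_of_nonneg_right (by exact_mod_cast hw) (hterm m)
            _ = ∑ v ∈ clus K {w}, (1 - s ^ m) := by
                rw [Finset.sum_const, nsmul_eq_mul]
            _ ≤ ∑ v ∈ clus K {w}, (1 + (-1) * s ^ #(clus K {v})) := by
                refine Finset.sum_le_sum fun v hv => ?_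
                rw [clus_singleton_eq hv]
                linarith [pow_le_pow_of_le_one hs hs1 hw]
            _ ≤ _ := Finset.sum_le_sum_of_subset_of_nonneg (Finset.subset_univ _)
                fun v _ _ => hnn v
        · rw [mul_zero]
          exact Finset.sum_nonneg fun v _ => hnn v
    _ = ∑ v, (1 + (-1) * percExp p G ∅ (fun K => s ^ #(clus K {v}))) := by
        unfold percExp
        rw [bexp_sum]
        refine Finset.sum_congr rfl fun v _ => ?_
        rw [bexp_add, bexp_const, bexp_const_mul]
    _ ≤ ∑ _v : V, 2 * y := Finset.sum_le_sum fun v _ => by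
        linarith [one_sub_le_percExp h hG hs hy0 hy1 hsy v]
    _ = _ := by
        simp
        ring

/-- A Bonferroni inequality of third order: multiplying by 1 - a leaves only a nonnegative remainder
in a⁴. -/
theorem one_sub_pow_ge {a : ℝ} (ha1 : a ≤ 1) (m : ℕ) :
    1 - m * a + m * (m - 1) / 2 * a ^ 2 - m * (m - 1) * (m - 2) / 6 * a ^ 3 ≤ (1 - a) ^ m := by
  induction m with
  | zero => simp
  | succ m ih =>
    have h1 := mul_le_mul_of_nonneg_left ih (sub_nonneg.2 ha1)
    have h2 : 0 ≤ (m : ℝ) * (m - 1) * (m - 2) := by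
      rcases m with _ | _ | m
      · simp
      · simp
      · push_cast
        have : (0 : ℝ) ≤ m := Nat.cast_nonneg m
        have e : ((m : ℝ) + 1 + 1) * (m + 1 + 1 - 1) * (m + 1 + 1 - 2) =
          (m + 2) * (m + 1) * m := by ring
        rw [e]
        positivity
    have h3 : 0 ≤ (m : ℝ) * (m - 1) * (m - 2) / 6 * a ^ 4 := by positivity
    rw [pow_succ' (1 - a) m]
    refine le_trans ?_ h1
    push_cast
    nlinarith

/-- With m = d - 1 and z = mpy = (1 + ε)y, the quadratic term is at least z²/4, since m ≥ 2, and the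
cubic one at most z³/6 ≤ z²/8, since z ≤ 3/4. The surplus z²/8 ≥ y²/10 pays for killing by σ and for
the drift ε. -/
theorem NearCritical.subsolution (h : NearCritical d p ε) {σ : ℝ} (hσ0 : 0 ≤ σ) (hσ1 : σ ≤ 1)
    (hy0 : 0 ≤ y) (hy1 : y ≤ 1 / 2) (hσ : σ + |ε| * y ≤ y ^ 2 / 10) :
    1 - y ≤ (1 - σ) * (1 - p * y) ^ (d - 1) := by
  have hd := h.three_le
  obtain ⟨m, rfl⟩ : ∃ m, d = m + 1 := ⟨d - 1, by omega⟩
  have hm : (2 : ℝ) ≤ m := by exact_mod_cast (by omega : 2 ≤ m)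
  have hp0 := h.nonneg
  have hp1 : p ≤ 1 := by linarith [h.le]
  have he := abs_le.1 h.abs_eps_le
  have hpm : p * m = 1 + ε := by
    have := h.eq
    push_cast at this
    linarith
  have h1 := one_sub_pow_ge (a := p * y) (by nlinarith) m
  rw [Nat.add_sub_cancel]
  set z : ℝ := (1 + ε) * y with hz
  have hmz : m * (p * y) = z := by rw [hz, ← hpm]; ring
  have hz0 : 0 ≤ z := mul_nonneg (by linarith) hy0
  have hz1 : z ≤ 3 / 4 := by nlinarith
  have h2 : 1 - z + z ^ 2 / 8 ≤ (1 - p * y) ^ m := by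
    refine le_trans ?_ h1
    set a := p * y
    have ha0 : 0 ≤ a := by positivity
    have h3 : z ^ 2 / 4 ≤ m * (m - 1) / 2 * a ^ 2 := by
      rw [← hmz]
      nlinarith [mul_nonneg (mul_nonneg (sub_nonneg.2 hm) (by linarith : (0 : ℝ) ≤ m))
        (sq_nonneg a)]
    have h4 : (m : ℝ) * (m - 1) * (m - 2) / 6 * a ^ 3 ≤ z ^ 3 / 6 := by
      rw [← hmz]
      have h5 : (m : ℝ) * (m - 1) * (m - 2) ≤ m ^ 3 := by nlinarith
      have h6 := mul_le_mul_of_nonneg_right h5 (pow_nonneg ha0 3)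
      nlinarith
    have h7 : z ^ 3 / 6 ≤ z ^ 2 / 8 := by nlinarith [sq_nonneg z]
    linarith
  have h8 : 9 / 10 * y ≤ z := by rw [hz]; nlinarith
  have h9 : ε * y ≤ |ε| * y := mul_le_mul_of_nonneg_right (le_abs_self ε) hy0
  have h10 : y ^ 2 / 10 ≤ z ^ 2 / 8 := by nlinarith
  calc 1 - y ≤ 1 - z + z ^ 2 / 8 - σ := by
        have : z = y + ε * y := by rw [hz]; ring
        linarith
    _ ≤ (1 - σ) * (1 - z + z ^ 2 / 8) := by
        have : 0 ≤ z - z ^ 2 / 8 := by nlinarith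
        nlinarith [mul_nonneg hσ0 this]
    _ ≤ _ := mul_le_mul_of_nonneg_left h2 (by linarith)

end UpperBound

/-! ### From the measures to finite sums -/

section MeasureLink

open scoped Classical
open Finset

variable {V : Type*} [Fintype V]

theorem coe_edgesOff_empty (G : SimpleGraph V) : (edgesOff G ∅ : Set (Sym2 V)) = G.edgeSet := by
  ext e
  simp [edgesOff]

/-- The Bernoulli law is carried by the finitely many subsets of the edge set, whose point masses
are exactly the weights in `bexp`. -/
theorem percolation_real_eq (G : SimpleGraph V) (p : unitInterval) (S : Set (SimpleGraph V)) :
    (percolation G p).real S = percExp p G ∅ (fun K => if K ∈ S then 1 else 0) := by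
  have hmeas : Measurable (SimpleGraph.fromEdgeSet : Set (Sym2 V) → SimpleGraph V) :=
    SimpleGraph.measurable_fromEdgeSet
  rw [percolation, measureReal_def, Measure.map_apply hmeas (Set.toFinite S).measurableSet,
    setBernoulli_apply_eq_apply_subsets, ← measureReal_def]
  set F : Finset (Set (Sym2 V)) := ((edgesOff G ∅).powerset.filter
    fun T : Finset (Sym2 V) => SimpleGraph.fromEdgeSet (↑T : Set (Sym2 V)) ∈ S).image
      (fun T : Finset (Sym2 V) => (↑T : Set (Sym2 V))) with hF
  have hFset : {s | s ∈ SimpleGraph.fromEdgeSet ⁻¹' S ∧ s ⊆ G.edgeSet} =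
      (F : Set (Set (Sym2 V))) := by
    ext s
    simp only [hF, Finset.coe_image, Set.mem_image, Finset.mem_coe, Finset.mem_filter,
      Finset.mem_powerset, Set.mem_ofPred_eq, Set.mem_preimage]
    constructor
    · rintro ⟨h1, h2⟩
      refine ⟨(Set.toFinite s).toFinset, ⟨?_, by simpa using h1⟩, by simp⟩
      rw [← Finset.coe_subset, coe_edgesOff_empty]
      simpa using h2
    · rintro ⟨T, ⟨h1, h2⟩, rfl⟩
      refine ⟨h2, ?_⟩
      rw [← coe_edgesOff_empty]
      exact Finset.coe_subset.2 h1
  rw [hFset, ← sum_measureReal_singleton, hF,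
    Finset.sum_image fun T _ T' _ h => Finset.coe_injective h, Finset.sum_filter, percExp, bexp]
  refine Finset.sum_congr rfl fun T hT => ?_
  have hT' : (T : Set (Sym2 V)) ⊆ G.edgeSet := by
    rw [← coe_edgesOff_empty]
    exact Finset.coe_subset.2 (Finset.mem_powerset.1 hT)
  split_ifs
  · rw [setBernoulli_real_singleton p hT' (Set.toFinite _), Set.ncard_coe_finset,
      ← coe_edgesOff_empty, ← Finset.coe_sdiff, Set.ncard_coe_finset,
      Finset.card_sdiff_of_subset (Finset.mem_powerset.1 hT), mul_one]
  · rw [mul_zero]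

theorem percolatedRegularGraph_real_eq {n d : ℕ} (p : unitInterval)
    (S : Set (SimpleGraph (Fin n))) :
    (percolatedRegularGraph n d p).real S =
      (∑ G ∈ (Set.toFinite (regularGraphs n d)).toFinset, (percolation G p).real S) /
        #(Set.toFinite (regularGraphs n d)).toFinset := by
  set F := (Set.toFinite (regularGraphs n d)).toFinset with hF
  have hFc : regularGraphs n d = (F : Set (SimpleGraph (Fin n))) := by simp [hF]
  have hfin : ∀ G : SimpleGraph (Fin n), percolation G p S ≠ ⊤ := fun G => by
    have : IsProbabilityMeasure (percolation G p) :=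
      Measure.isProbabilityMeasure_map SimpleGraph.measurable_fromEdgeSet.aemeasurable
    exact measure_ne_top _ _
  rw [percolatedRegularGraph, measureReal_def, Measure.bind_apply (Set.toFinite S).measurableSet
    (measurable_of_finite _).aemeasurable, hFc, uniformOn, ProbabilityTheory.cond,
    lintegral_smul_measure, lintegral_finset, Measure.count_apply_finset]
  simp only [Measure.count_singleton, mul_one, smul_eq_mul, ENNReal.toReal_mul,
    ENNReal.toReal_inv, ENNReal.toReal_natCast]
  rw [ENNReal.toReal_sum fun G _ => hfin G, div_eq_inv_mul]
  rfl

theorem card_clus_le_largestComponentOrder (K : SimpleGraph V) (w : V) :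
    #(clus K {w}) ≤ largestComponentOrder K := by
  have h : #(clus K {w}) = (K.connectedComponentMk w).supp.ncard := by
    rw [← Set.ncard_coe_finset]
    congr 1
    ext x
    simp [SimpleGraph.reachable_comm]
  rw [h]
  exact le_ciSup (f := fun C : K.ConnectedComponent => C.supp.ncard) (Set.toFinite _).bddAbove _

theorem exists_card_clus_eq_largestComponentOrder [Nonempty V] (K : SimpleGraph V) :
    ∃ w, #(clus K {w}) = largestComponentOrder K := by
  obtain ⟨C, hC⟩ := exists_eq_ciSup_of_finite (f := fun C : K.ConnectedComponent => C.supp.ncard)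
  obtain ⟨w, rfl⟩ := C.exists_rep
  refine ⟨w, ?_⟩
  rw [largestComponentOrder, ← hC, ← Set.ncard_coe_finset]
  congr 1
  ext x
  change _ ↔ x ∈ (K.connectedComponentMk w).supp
  simp [SimpleGraph.reachable_comm]

end MeasureLink

/-! ### Choice of scales and combination of the tails -/

section Conclusion

open scoped Classical
open Finset

variable {d : ℕ} {p ε : ℝ}

/-- The probability that all clusters have fewer than `k` vertices. -/
noncomputable def probAllSmall {V : Type*} [Fintype V] (p : ℝ) (G : SimpleGraph V) (k : ℕ) : ℝ :=
  percExp p G ∅ (fun K => if ∀ w, #(clus K {w}) < k then 1 else 0)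

/-- The probability that some cluster has at least `m` vertices. -/
noncomputable def probSomeLarge {V : Type*} [Fintype V] (p : ℝ) (G : SimpleGraph V) (m : ℕ) : ℝ :=
  percExp p G ∅ (fun K => if ∃ w, m ≤ #(clus K {w}) then 1 else 0)

theorem probAllSmall_zero {V : Type*} [Fintype V] [Nonempty V] (G : SimpleGraph V) :
    probAllSmall p G 0 = 0 := by
  simpa [probAllSmall] using percExp_const 0

theorem percExp_component_order_le {V : Type*} [Fintype V] [Nonempty V] {G : SimpleGraph V}
    (hp0 : 0 ≤ p) (hp1 : p ≤ 1) {S : Set (SimpleGraph V)} {k m : ℕ}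
    (hS : ∀ K ∈ S, largestComponentOrder K < k ∨ m ≤ largestComponentOrder K) :
    percExp p G ∅ (fun K => if K ∈ S then 1 else 0) ≤
      probAllSmall p G k + probSomeLarge p G m := by
  unfold probAllSmall probSomeLarge percExp
  rw [← bexp_add]
  refine bexp_mono hp0 hp1 fun T _ => ?_
  dsimp only
  set K := SimpleGraph.fromEdgeSet (T : Set (Sym2 V))
  by_cases hK : K ∈ S
  · rw [if_pos hK]
    rcases hS K hK with h | h
    · rw [if_pos fun w => (card_clus_le_largestComponentOrder K w).trans_lt h]
      split_ifs <;> norm_num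
    · obtain ⟨w, hw⟩ := exists_card_clus_eq_largestComponentOrder K
      rw [if_pos (c := ∃ w, m ≤ #(clus K {w})) ⟨w, hw ▸ h⟩]
      split_ifs <;> norm_num
  · rw [if_neg hK]
    split_ifs <;> norm_num

theorem mem_regularGraphs_iff {n : ℕ} {G : SimpleGraph (Fin n)} :
    G ∈ regularGraphs n d ↔ ∀ v, #(nb G v) = d := by
  refine forall_congr' fun v => ?_
  rw [← Set.ncard_coe_finset]
  have : G.neighborSet v = (nb G v : Set (Fin n)) := by ext; simp
  rw [this]

/-- Bounds for both tails of the order of the largest component, averaged over the regular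
graphs. -/
theorem percolatedRegularGraph_real_le {n : ℕ} {q : unitInterval} {c₁ c₂ : ℝ} (hc : 0 ≤ c₁ + c₂)
    (hn : 0 < n) {S : Set (SimpleGraph (Fin n))} {k m : ℕ}
    (hS : ∀ K ∈ S, largestComponentOrder K < k ∨ m ≤ largestComponentOrder K)
    (hlow : ∀ G₀ : SimpleGraph (Fin n), (∀ v, #(nb G₀ v) = d) →
      ∑ G ∈ regFamily d G₀ ∅,
        probAllSmall q G k ≤
          #(regFamily d G₀ ∅) * c₁)
    (hup : ∀ G : SimpleGraph (Fin n), (∀ v, #(nb G v) = d) →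
      probSomeLarge q G m ≤ c₂) :
    (percolatedRegularGraph n d q).real S ≤ c₁ + c₂ := by
  have : Nonempty (Fin n) := ⟨⟨0, hn⟩⟩
  rw [percolatedRegularGraph_real_eq]
  rcases (regularGraphs n d).eq_empty_or_nonempty with he | ⟨G₀, hG₀⟩
  -- An empty family gives the quotient 0 / 0 = 0.
  · simp [he, hc]
  · have hF : (Set.toFinite (regularGraphs n d)).toFinset = regFamily d G₀ ∅ := by
      ext G
      simp [mem_regFamily, mem_regularGraphs_iff]
    rw [hF]
    have hpos : (0 : ℝ) < #(regFamily d G₀ ∅) := by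
      rw [← hF]
      exact_mod_cast Finset.card_pos.2 ⟨G₀, by simpa using hG₀⟩
    rw [div_le_iff₀ hpos]
    calc _ ≤ ∑ G ∈ regFamily d G₀ ∅,
          (probAllSmall q G k + c₂) := by
          refine Finset.sum_le_sum fun G hG => ?_
          rw [percolation_real_eq]
          exact (percExp_component_order_le q.2.1 q.2.2 hS).trans
            (add_le_add le_rfl (hup G (mem_regFamily.1 hG).1))
      _ ≤ #(regFamily d G₀ ∅) * c₁ + #(regFamily d G₀ ∅) * c₂ := by
          rw [Finset.sum_add_distrib, Finset.sum_const, nsmul_eq_mul]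
          exact add_le_add (hlow G₀ (mem_regularGraphs_iff.1 hG₀)) le_rfl
      _ = _ := by ring

/-- The upper tail. -/
theorem percExp_exists_large_le_div {V : Type*} [Fintype V] {G : SimpleGraph V} {N lam A : ℝ}
    {m : ℕ} (h : NearCritical d p (lam / N)) (hG : ∀ v, #(nb G v) = d)
    (hV : (Fintype.card V : ℝ) = N ^ 3) (hN : 20 * (1 + |lam|) ≤ N) (hA : 1 ≤ A)
    (hm : A * N ^ 2 ≤ m) :
    probSomeLarge p G m ≤
      40 * (1 + |lam|) / A := by
  have hl := abs_nonneg lam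
  have hN0 : 0 < N := by linarith
  set L := 1 + |lam| with hL
  -- After multiplication by N², the subsolution condition becomes 1 + 10|λ|L ≤ 10L², which holds as
  -- L = 1 + |λ|.
  set y := 10 * L / N with hy
  set σ := 1 / N ^ 2 with hσ
  have hσ0 : 0 ≤ σ := by positivity
  have hN1 : 1 ≤ N := by linarith
  have hσ1 : σ ≤ 1 := by
    rw [hσ, div_le_one (by positivity)]
    nlinarith
  have hy0 : 0 ≤ y := by positivity
  have hy1 : y ≤ 1 / 2 := by
    rw [hy, div_le_iff₀ hN0]
    linarith
  have hsub : σ + |lam / N| * y ≤ y ^ 2 / 10 := by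
    rw [abs_div, abs_of_pos hN0, hσ, hy]
    have : 1 / N ^ 2 + |lam| / N * (10 * L / N) = (1 + 10 * |lam| * L) / N ^ 2 := by
      field_simp
    rw [this, div_pow, div_div, mul_comm (N ^ 2) 10, ← div_div]
    refine div_le_div_of_nonneg_right ?_ (by positivity)
    nlinarith
  have h1 := percExp_exists_large_le h hG (sub_nonneg.2 hσ1) (by linarith) hy0 (by linarith)
    (h.subsolution hσ0 hσ1 hy0 hy1 hsub) m
  change probSomeLarge p G m * _ ≤ _ at h1
  set P := probSomeLarge p G m
  have hP : 0 ≤ P := by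
    calc (0 : ℝ) = percExp p G ∅ (fun _ => 0) := (percExp_const 0).symm
      _ ≤ P := percExp_mono h.nonneg (by linarith [h.le]) fun K _ => by split_ifs <;> norm_num
  have hpow : (1 - σ) ^ m ≤ 1 / 2 := by
    calc (1 - σ) ^ m ≤ Real.exp (-σ) ^ m :=
          pow_le_pow_left₀ (sub_nonneg.2 hσ1) (by linarith [Real.add_one_le_exp (-σ)]) m
      _ = Real.exp (m * (-σ)) := by rw [← Real.exp_nat_mul]
      _ ≤ Real.exp (-1) := by
          refine Real.exp_le_exp.2 ?_
          have : 1 ≤ m * σ := by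
            rw [hσ, mul_one_div, one_le_div (by positivity)]
            nlinarith [sq_nonneg N]
          linarith
      _ ≤ 1 / 2 := by
          rw [Real.exp_neg, inv_eq_one_div]
          exact one_div_le_one_div_of_le (by norm_num) (by linarith [Real.add_one_le_exp (1 : ℝ)])
  have hm' : A * N ^ 2 * (1 / 2) ≤ m * (1 - (1 - σ) ^ m) :=
    mul_le_mul hm (by linarith) (by norm_num) (Nat.cast_nonneg _)
  have h2 := (mul_le_mul_of_nonneg_left hm' hP).trans h1
  rw [hV] at h2
  have h3 : 2 * y * N ^ 3 = 20 * L * N ^ 2 := by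
    rw [hy]
    field_simp
    ring
  rw [h3] at h2
  rw [le_div_iff₀ (by linarith)]
  have hN2 : 0 < N ^ 2 := by positivity
  refine le_of_mul_le_mul_right ?_ hN2
  linarith

/-- The lower tail, in terms of `r = A ^ (1 / 10)`. -/
theorem sum_percExp_small_le_inv {V : Type*} [Fintype V] {G₀ : SimpleGraph V} {N lam r : ℝ}
    (h : NearCritical d p (lam / N)) (hG₀ : ∀ v, #(nb G₀ v) = d)
    (hV : (Fintype.card V : ℝ) = N ^ 3) (hr : 10 ^ 8 * (1 + |lam|) ≤ r) (hrN : r ^ 5 ≤ N) :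
    ∑ G ∈ regFamily d G₀ ∅, probAllSmall p G ⌈N ^ 2 / r ^ 10⌉₊ ≤
      #(regFamily d G₀ ∅) * (1 / r ^ 5) := by
  have hl := abs_nonneg lam
  have hr8 : (10 : ℝ) ^ 8 ≤ r := by nlinarith
  have hr0 : 0 < r := by linarith [show (0 : ℝ) < 10 ^ 8 by norm_num]
  have hr1 : 1 ≤ r := by linarith [show (1 : ℝ) ≤ 10 ^ 8 by norm_num]
  have hr5 : r ≤ r ^ 5 := le_self_pow₀ hr1 (by norm_num)
  have hrN' : r ≤ N := hr5.trans hrN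
  have hN0 : 0 < N := by linarith
  have hN1 : 1 ≤ N := by linarith
  have hr10 : r ^ 10 ≤ N ^ 2 := by
    calc r ^ 10 = (r ^ 5) ^ 2 := by ring
      _ ≤ N ^ 2 := pow_le_pow_left₀ (by positivity) hrN 2
  set k := ⌈N ^ 2 / r ^ 10⌉₊ with hk
  -- Long compared with H² = N²/r⁴, yet HT₁/n is about 10^-5, so the accumulated overlap drift stays
  -- below the allowed 1/20.
  set T₁ := ⌈r ^ 2 * N ^ 2 / 10 ^ 5⌉₊ with hT₁
  have hx1 : 1 ≤ N ^ 2 / r ^ 10 := by rwa [one_le_div (by positivity)]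
  have hk1 : (k : ℝ) ≤ N ^ 2 / r ^ 10 + 1 := (Nat.ceil_lt_add_one (by positivity)).le
  have hT1 : (T₁ : ℝ) ≤ r ^ 2 * N ^ 2 / 10 ^ 5 + 1 := (Nat.ceil_lt_add_one (by positivity)).le
  have hT1' : r ^ 2 * N ^ 2 / 10 ^ 5 ≤ (T₁ : ℝ) := Nat.le_ceil _
  have hrsq : (10 : ℝ) ^ 16 ≤ r ^ 2 := by nlinarith
  have hT1pos : (0 : ℝ) < T₁ := lt_of_lt_of_le (by positivity) hT1'
  have hxN : N ^ 2 / r ^ 10 ≤ N ^ 2 := div_le_self (by positivity) (one_le_pow₀ hr1)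
  have hNsq : 1 ≤ N ^ 2 := one_le_pow₀ hN1
  have hT : ((T₁ + k : ℕ) : ℝ) ≤ r ^ 2 * N ^ 2 / 50000 := by
    push_cast
    have : (10 : ℝ) ^ 16 * N ^ 2 ≤ r ^ 2 * N ^ 2 := mul_le_mul_of_nonneg_right hrsq (by positivity)
    linarith
  have hr3N : r ^ 3 * r ^ 2 ≤ N := by rwa [← pow_add]
  have hr3 : (10 : ℝ) ^ 8 ≤ r ^ 3 := hr8.trans (le_self_pow₀ hr1 (by norm_num))
  have hr2N : r ^ 2 / N ≤ 1 / 10 ^ 8 := by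
    rw [div_le_div_iff₀ hN0 (by norm_num)]
    nlinarith [sq_nonneg r]
  have hcard : 16 * (T₁ + k) ≤ Fintype.card V := by
    have : (16 * ((T₁ + k : ℕ) : ℝ)) ≤ Fintype.card V := by
      rw [hV]
      have h1 : r ^ 2 ≤ N := by
        rw [div_le_iff₀ hN0] at hr2N
        linarith
      have h2 : r ^ 2 * N ^ 2 ≤ N * N ^ 2 := mul_le_mul_of_nonneg_right h1 (by positivity)
      nlinarith
    exact_mod_cast this
  have hk0 : 0 < k := Nat.ceil_pos.2 (by linarith)
  have hT0 : 0 < T₁ := by exact_mod_cast hT1pos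
  have hH : 1 ≤ N / r ^ 2 := by
    rw [one_le_div (by positivity)]
    rw [div_le_iff₀ hN0] at hr2N
    linarith
  have hdrift : 2 * (N / r ^ 2) * (3 / 2 * |lam / N| +
      3 * (24 / Fintype.card V * (N / r ^ 2 + 3 * ((T₁ + k : ℕ) : ℝ)))) +
      3 * (24 / Fintype.card V * (N / r ^ 2 + 3 * ((T₁ + k : ℕ) : ℝ))) + 252 / (N / r ^ 2) ≤
      1 / 20 := by
    have hκ : 24 / (Fintype.card V : ℝ) * (N / r ^ 2 + 3 * ((T₁ + k : ℕ) : ℝ)) ≤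
        24 / N ^ 2 + 144 / 10 ^ 5 * (r ^ 2 / N) := by
      calc _ ≤ 24 / (Fintype.card V : ℝ) * (N / 1 + 3 * (r ^ 2 * N ^ 2 / 50000)) := by
            gcongr
            exact one_le_pow₀ hr1
        _ = _ := by
            rw [hV]
            field_simp
            ring
    set κ := 24 / (Fintype.card V : ℝ) * (N / r ^ 2 + 3 * ((T₁ + k : ℕ) : ℝ))
    have hHκ : N / r ^ 2 * κ ≤ 24 / N + 144 / 10 ^ 5 := by
      calc N / r ^ 2 * κ ≤ N / r ^ 2 * (24 / N ^ 2 + 144 / 10 ^ 5 * (r ^ 2 / N)) :=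
            mul_le_mul_of_nonneg_left hκ (by positivity)
        _ = 24 / N / r ^ 2 + 144 / 10 ^ 5 := by
            field_simp
        _ ≤ _ := by
            have := div_le_self (a := 24 / N) (by positivity) (one_le_pow₀ hr1 (n := 2))
            linarith
    have hN24 : 24 / N ≤ 24 / 10 ^ 8 := by
      gcongr
      linarith
    have hNN : 24 / N ^ 2 ≤ 24 / N := by
      gcongr
      exact le_self_pow₀ hN1 (by norm_num)
    have hlam : N / r ^ 2 * |lam / N| ≤ 1 / 10 ^ 8 := by
      rw [abs_div, abs_of_pos hN0]
      have : N / r ^ 2 * (|lam| / N) = |lam| / r ^ 2 := by field_simp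
      rw [this, div_le_div_iff₀ (by positivity) (by norm_num)]
      nlinarith
    have h252 : 252 / (N / r ^ 2) = 252 * (r ^ 2 / N) := by field_simp
    rw [h252]
    have e : 2 * (N / r ^ 2) * (3 / 2 * |lam / N| + 3 * κ) =
      3 * (N / r ^ 2 * |lam / N|) + 6 * (N / r ^ 2 * κ) := by ring
    rw [e]
    norm_num at *
    linarith
  refine (sum_percExp_small_le h hH hcard (by omega) hT0 le_rfl hk0 hdrift hG₀).trans
    (mul_le_mul_of_nonneg_left ?_ (Nat.cast_nonneg _))
  have h1 : 80 * (N / r ^ 2) ^ 2 / T₁ ≤ 8 * 10 ^ 6 / r ^ 6 := by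
    calc 80 * (N / r ^ 2) ^ 2 / T₁ ≤ 80 * (N / r ^ 2) ^ 2 / (r ^ 2 * N ^ 2 / 10 ^ 5) := by gcongr
      _ = _ := by
        field_simp
        norm_num
  have h2 : 145 * (k : ℝ) / (N / r ^ 2) ^ 2 ≤ 290 / r ^ 6 := by
    calc 145 * (k : ℝ) / (N / r ^ 2) ^ 2 ≤ 145 * (2 * (N ^ 2 / r ^ 10)) / (N / r ^ 2) ^ 2 := by
          gcongr
          linarith
      _ = _ := by
        field_simp
        norm_num
  -- The spare factor r ≥ 10^8 swallows both numerical constants.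
  have h3 : (8 * 10 ^ 6 + 290) / r ^ 6 ≤ 1 / r ^ 5 := by
    rw [div_le_div_iff₀ (by positivity) (by positivity)]
    have : (0 : ℝ) < r ^ 5 := by positivity
    calc (8 * 10 ^ 6 + 290) * r ^ 5 ≤ r * r ^ 5 := by
          refine mul_le_mul_of_nonneg_right ?_ this.le
          norm_num at hr8
          linarith
      _ = 1 * r ^ 6 := by ring
  rw [add_div] at h3
  linarith

end Conclusion

theorem theorem1 (lam : ℝ) :
    ∃ (A₀ : ℝ) (n₀ : ℕ), ∀ n d : ℕ, n₀ ≤ n → 3 ≤ d → d ≤ n - 1 → Even (n * d) →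
      ∃ p : unitInterval,
        (p : ℝ) = (1 + lam * (n : ℝ) ^ (-(1 / 3) : ℝ)) / ((d : ℝ) - 1) ∧
        ∀ A : ℝ, A₀ ≤ A →
          (percolatedRegularGraph n d p).real
            {H | (largestComponentOrder H : ℝ) ∉
              Set.Icc (A⁻¹ * (n : ℝ) ^ (2 / 3 : ℝ)) (A * (n : ℝ) ^ (2 / 3 : ℝ))}
            ≤ 20 * A ^ (-(1 / 2) : ℝ) := by
  have hl := abs_nonneg lam
  set L := 1 + |lam| with hL
  -- These give r = A^(1/10) ≥ 10^8 L and N ≥ 20L; the latter ensures |ε| ≤ 1/10 and y = 10L/N ≤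
  -- 1/2.
  refine ⟨(10 ^ 8 * L) ^ 10, ⌈(20 * L) ^ 3⌉₊ + 1, fun n d hn hd _ _ => ?_⟩
  have hn0 : 0 < n := by omega
  have hn0' : (0 : ℝ) < n := by exact_mod_cast hn0
  set N : ℝ := (n : ℝ) ^ (1 / 3 : ℝ) with hN
  have hN0 : 0 < N := Real.rpow_pos_of_pos hn0' _
  have hN3 : N ^ 3 = n := by
    rw [hN, ← Real.rpow_natCast, ← Real.rpow_mul hn0'.le]
    norm_num
  have hN2 : (n : ℝ) ^ (2 / 3 : ℝ) = N ^ 2 := by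
    rw [hN, ← Real.rpow_natCast, ← Real.rpow_mul hn0'.le]
    norm_num
  have hNi : (n : ℝ) ^ (-(1 / 3) : ℝ) = 1 / N := by
    rw [Real.rpow_neg hn0'.le, hN, one_div (_ ^ _)]
  have hNL : 20 * L ≤ N := by
    refine le_of_pow_le_pow_left₀ (n := 3) (by norm_num) hN0.le ?_
    rw [hN3]
    refine (Nat.le_ceil _).trans ?_
    exact_mod_cast (by omega : ⌈(20 * L) ^ 3⌉₊ ≤ n)
  have hd1 := one_lt_cast hd
  have hcrit : NearCritical d ((1 + lam * (n : ℝ) ^ (-(1 / 3) : ℝ)) / ((d : ℝ) - 1)) (lam / N) := by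
    refine ⟨hd, ?_, ?_⟩
    · rw [abs_div, abs_of_pos hN0, div_le_iff₀ hN0]
      linarith
    · rw [div_mul_cancel₀ _ (by linarith), hNi, mul_one_div]
  refine ⟨⟨_, hcrit.nonneg, by linarith [hcrit.le]⟩, rfl, fun A hA => ?_⟩
  set q : unitInterval := ⟨_, hcrit.nonneg, by linarith [hcrit.le]⟩
  have hR1 : (1 : ℝ) ≤ 10 ^ 8 * L := by linarith
  have hA1 : 1 ≤ A := (one_le_pow₀ hR1).trans hA
  have hA0 : 0 < A := by linarith
  set r : ℝ := A ^ (1 / 10 : ℝ) with hr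
  have hr0 : 0 < r := Real.rpow_pos_of_pos hA0 _
  have hr10 : r ^ 10 = A := by
    rw [hr, ← Real.rpow_natCast, ← Real.rpow_mul hA0.le]
    norm_num
  have hr5 : A ^ (-(1 / 2) : ℝ) = 1 / r ^ 5 := by
    rw [Real.rpow_neg hA0.le, hr, ← Real.rpow_natCast, ← Real.rpow_mul hA0.le, one_div]
    norm_num
  have hrL : 10 ^ 8 * L ≤ r := by
    refine le_of_pow_le_pow_left₀ (n := 10) (by norm_num) hr0.le ?_
    rwa [hr10]
  have hr1 : 1 ≤ r := hR1.trans hrL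
  have hV : (Fintype.card (Fin n) : ℝ) = N ^ 3 := by rw [Fintype.card_fin, hN3]
  rw [hN2, hr5]
  have hup : 40 * L / A ≤ 1 / r ^ 5 := by
    rw [div_le_div_iff₀ hA0 (by positivity), ← hr10]
    have h1 : 40 * L ≤ r ^ 5 := by
      refine le_trans ?_ (le_self_pow₀ hr1 (by norm_num))
      linarith
    calc 40 * L * r ^ 5 ≤ r ^ 5 * r ^ 5 := mul_le_mul_of_nonneg_right h1 (by positivity)
      _ = 1 * r ^ 10 := by ring
  have hr5pos : 0 ≤ 1 / r ^ 5 := by positivity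
  have hn1 : Nonempty (Fin n) := ⟨⟨0, hn0⟩⟩
  have hlarge : ∀ K : SimpleGraph (Fin n), A * N ^ 2 < largestComponentOrder K →
      ⌈A * N ^ 2⌉₊ ≤ largestComponentOrder K := fun K hK => Nat.ceil_le.2 hK.le
  have hprob : ∀ G : SimpleGraph (Fin n), (∀ v, (nb G v).card = d) →
      probSomeLarge q G ⌈A * N ^ 2⌉₊ ≤ 40 * L / A := fun G hG =>
    percExp_exists_large_le_div hcrit hG hV hNL hA1 (Nat.le_ceil _)
  refine le_trans (b := 1 / r ^ 5 + 40 * L / A) ?_ (by linarith)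
  -- The climbing argument needs r⁵ ≤ N, that is A ≤ N². For larger A the lower threshold is below 1
  -- and no component can violate it, so k = 0 serves.
  rcases le_or_gt A (N ^ 2) with hAN | hAN
  · refine percolatedRegularGraph_real_le (d := d) (k := ⌈N ^ 2 / r ^ 10⌉₊) (m := ⌈A * N ^ 2⌉₊)
      (by positivity) hn0 ?_ ?_ hprob
    · intro K hK
      rw [Set.mem_ofPred_eq, Set.mem_Icc, not_and_or, not_le, not_le] at hK
      refine hK.imp (fun h => ?_) (hlarge K)
      rw [Nat.lt_ceil, hr10, div_eq_inv_mul]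
      exact h
    · intro G₀ hG₀
      refine sum_percExp_small_le_inv hcrit hG₀ hV hrL ?_
      refine le_of_pow_le_pow_left₀ (n := 2) (by norm_num) hN0.le ?_
      rwa [← pow_mul, hr10]
  · refine percolatedRegularGraph_real_le (d := d) (k := 0) (m := ⌈A * N ^ 2⌉₊)
      (by positivity) hn0 ?_ ?_ hprob
    · intro K hK
      rw [Set.mem_ofPred_eq, Set.mem_Icc, not_and_or, not_le, not_le] at hK
      refine Or.inr (hK.elim (fun h => ?_) (hlarge K))
      have h1 : A⁻¹ * N ^ 2 < 1 := by
        rw [inv_mul_lt_iff₀ hA0]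
        linarith
      obtain ⟨w, hw⟩ := exists_card_clus_eq_largestComponentOrder K
      have h2 : 1 ≤ largestComponentOrder K := by
        rw [← hw]
        exact Finset.card_pos.2 ⟨w, subset_clus _ _ (by simp)⟩
      have h3 : (1 : ℝ) ≤ largestComponentOrder K := by exact_mod_cast h2
      linarith
    · intro G₀ _
      simp only [probAllSmall_zero, Finset.sum_const_zero]
      positivity
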